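/- **Quantum-mechanical Lieb–Robinson bound.** Let $n\in\mathbb N$. For $a>0$ let $\mathcal S_a^n=\{\zeta\in\mathbb C^n : |\mathrm{Im}\,\zeta_j|<a \text{ for all } j\}$, and for $\xi\in\mathbb R^n$ let $T_\xi$ be the unitary operator of multiplication by $e^{-i\xi\cdot x}$ on $L^2(\mathbb R^n)$. A self-adjoint operator $H$ on $L^2(\mathbb R^n)$ is said to satisfy Condition (A) with parameter $a$ if the family $H_\xi=T_\xi H T_\xi^{-1}$, $\xi\in\mathbb R^n$, has a continuation $\zeta\mapsto H_\zeta$ to $\mathcal S_a^n$, analytic in the sense of Kato (for every $\zeta_0\in\mathcal S_a^n$ there is $z\in\mathbb C$ such that, for $\zeta$ near $\zeta_0$, $z$ is in the resolvent set of $H_\zeta$ and $(H_\zeta-z)^{-1}$ is analytic in $\zeta$), such that the operators $\mathrm{Im}\,H_\zeta=\frac1{2i}(H_\zeta-H_\zeta^*)$, $\zeta\in\mathcal S_a^n$, are bounded (that is, $H_\zeta$ is densely defined, $D(H_\zeta)\subseteq D(H_\zeta^*)$, and $\frac1{2i}(H_\zeta-H_\zeta^*)$ is bounded on $D(H_\zeta)$),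 and $\sup_{\zeta\in\mathcal S_{a'}^n}\|\mathrm{Im}\,H_\zeta\|<\infty$ for every $a'<a$. For a measurable set $X\subset\mathbb R^n$ let $\chi_X$ be the operator of multiplication by its characteristic function. A bounded operator $A$ on $L^2(\mathbb R^n)$ acts on $X$ if $A=\chi_XA\chi_X+\chi_{X^c}$. Let $\alpha_t(A)=e^{itH}Ae^{-itH}$, and for non-empty $X,Y$ let $d_{XY}=\inf\{|x-y| : x\in X,\ y\in Y\}$. There is a function $c\mapsto C(n,c)>0$ of $n$ and $c>0$ alone such that the following holds. Let $0<\mu<a$ and let $H$ be a self-adjoint operator on $L^2(\mathbb R^n)$ satisfying Condition (A) with parameter $a$. Then there is $c>0$ such that, with $C=C(n,c)$, for all non-empty measurable sets $X,Y\subset\mathbb R^n$ with $d_{XY}>0$, all bounded operators $A$ acting on $X$ and $B$ acting on $Y$, and all $t\in\mathbb R$, $$\|[\alpha_t(A),B]\|\le C\,e^{-\mu(d_{XY}-c|t|)}\,\|A\|\,\|B\|.$$ -/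

import Mathlib

open MeasureTheory Filter Topology
open scoped ENNReal

noncomputable section

namespace LiebRobinson

/-! ### The state space `L²(ℝⁿ)` and multiplication operators -/

/-- The configuration space `ℝⁿ` with its Euclidean norm. -/
abbrev Space (n : ℕ) := EuclideanSpace ℝ (Fin n)

/-- The complex Hilbert space `L²(ℝⁿ)`. -/
abbrev L2 (n : ℕ) := Lp ℂ 2 (volume : Measure (Space n))

/-- Multiplication by a (measurable, essentially bounded) function `φ`, as a bounded operator on
`L²(ℝⁿ)`. -/
def mulOp {n : ℕ} (φ : Space n → ℂ) (hφ : MemLp φ ∞ (volume : Measure (Space n))) :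
    L2 n →L[ℂ] L2 n :=
  (ContinuousLinearMap.mul ℂ ℂ).holderL volume ∞ 2 2 hφ.toLp

theorem mulOp_apply_ae {n : ℕ} (φ : Space n → ℂ) (hφ : MemLp φ ∞ (volume : Measure (Space n)))
    (ψ : L2 n) : mulOp φ hφ ψ =ᵐ[volume] fun x => φ x * ψ x := by
  have h1 := (ContinuousLinearMap.mul ℂ ℂ).coeFn_holder (r := 2) hφ.toLp ψ
  filter_upwards [h1, hφ.coeFn_toLp] with x hx hx'
  simp only [mulOp, ContinuousLinearMap.holderL_apply_apply, hx, hx',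
    ContinuousLinearMap.mul_apply']

theorem memLp_indicator {n : ℕ} {X : Set (Space n)} (hX : MeasurableSet X) :
    MemLp (X.indicator fun _ => (1 : ℂ)) ∞ (volume : Measure (Space n)) :=
  memLp_top_of_bound ((measurable_const.indicator hX).aestronglyMeasurable) 1
    (Eventually.of_forall fun x => by
      by_cases hx : x ∈ X <;> simp [hx])

/-- The operator `χ_X` of multiplication by the characteristic function of `X`. -/
def chi {n : ℕ} (X : Set (Space n)) (hX : MeasurableSet X) : L2 n →L[ℂ] L2 n :=
  mulOp (X.indicator fun _ => (1 : ℂ)) (memLp_indicator hX)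

/-- The function `x ↦ e^{-i ξ·x}`. -/
def planeWave {n : ℕ} (ξ : Space n) (x : Space n) : ℂ :=
  Complex.exp (-Complex.I * ((inner ℝ ξ x : ℝ) : ℂ))

theorem memLp_planeWave {n : ℕ} (ξ : Space n) :
    MemLp (planeWave ξ) ∞ (volume : Measure (Space n)) := by
  refine memLp_top_of_bound (Continuous.aestronglyMeasurable ?_) 1
    (Eventually.of_forall fun x => ?_)
  · unfold planeWave
    fun_prop
  · simp [planeWave, Complex.norm_exp]

/-- The unitary operator `T_ξ` of multiplication by `e^{-i ξ·x}`. Its inverse is `T_{-ξ}`. -/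
def T {n : ℕ} (ξ : Space n) : L2 n →L[ℂ] L2 n := mulOp (planeWave ξ) (memLp_planeWave ξ)

theorem T_comp_T_neg {n : ℕ} (ξ : Space n) : T ξ ∘L T (-ξ) = ContinuousLinearMap.id ℂ (L2 n) := by
  ext1 ψ
  apply Lp.ext
  filter_upwards [mulOp_apply_ae (planeWave ξ) (memLp_planeWave ξ) (T (-ξ) ψ),
    mulOp_apply_ae (planeWave (-ξ)) (memLp_planeWave (-ξ)) ψ] with x h1 h2
  change (mulOp (planeWave ξ) (memLp_planeWave ξ) (T (-ξ) ψ)) x = ψ x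
  rw [h1]
  change planeWave ξ x * (mulOp (planeWave (-ξ)) (memLp_planeWave (-ξ)) ψ) x = ψ x
  rw [h2, ← mul_assoc]
  simp [planeWave, ← Complex.exp_add]

/-- The operator `A` acts on `X`: `A = χ_X A χ_X + χ_{Xᶜ}`. -/
def ActsOn {n : ℕ} (A : L2 n →L[ℂ] L2 n) (X : Set (Space n)) (hX : MeasurableSet X) : Prop :=
  A = chi X hX ∘L A ∘L chi X hX + chi Xᶜ hX.compl

/-- The distance `d_{XY} = inf {|x - y| : x ∈ X, y ∈ Y}` of two non-empty sets (it is `0` if one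
of them is empty). -/
def setDist {n : ℕ} (X Y : Set (Space n)) : ℝ := sInf (Set.image2 dist X Y)

/-! ### Unbounded operators -/

section Unbounded

variable {E : Type*} [NormedAddCommGroup E] [InnerProductSpace ℂ E] [CompleteSpace E]

/-- For bounded operators `S`, `S'` and an unbounded operator `H`, the unbounded operator `S H S'`
on its natural domain `{ψ : S' ψ ∈ D(H)}`. -/
def sandwich (S : E →L[ℂ] E) (H : E →ₗ.[ℂ] E) (S' : E →L[ℂ] E) : E →ₗ.[ℂ] E where
  domain := H.domain.comap (S' : E →ₗ[ℂ] E)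
  toFun := (S : E →ₗ[ℂ] E) ∘ₗ H.toFun ∘ₗ (S' : E →ₗ[ℂ] E).restrict (fun _ hψ => hψ)

/-- `U` is a strongly continuous one-parameter group of unitary operators whose infinitesimal
generator is `-iH`, i.e. `(ψ, φ)` lies in the graph of `H` exactly when `t ↦ U_t ψ` is
differentiable at `0` with derivative `-iφ`. -/
structure IsUnitaryGroupOf (H : E →ₗ.[ℂ] E) (U : ℝ → E →L[ℂ] E) : Prop where
  map_zero : U 0 = 1
  map_add : ∀ s t : ℝ, U (s + t) = U s ∘L U t
  norm_map : ∀ (t : ℝ) (ψ : E), ‖U t ψ‖ = ‖ψ‖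
  continuous : ∀ ψ : E, Continuous fun t => U t ψ
  mem_graph_iff : ∀ ψ φ : E,
    (ψ, φ) ∈ H.graph ↔ HasDerivAt (fun t : ℝ => U t ψ) (-(Complex.I • φ)) 0

open Classical in
/-- The propagator `t ↦ e^{-itH}` of a self-adjoint operator `H`: the unitary group generated by
`-iH`, which exists and is unique by Stone's theorem. (For operators `H` that do not generate a
unitary group it is set to `0`.) -/
def propagator (H : E →ₗ.[ℂ] E) : ℝ → E →L[ℂ] E :=
  if h : ∃ U : ℝ → E →L[ℂ] E, IsUnitaryGroupOf H U then h.choose else 0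

/-- The Heisenberg evolution `α_t(A) = e^{itH} A e^{-itH}`. -/
def heisenberg (H : E →ₗ.[ℂ] E) (t : ℝ) (A : E →L[ℂ] E) : E →L[ℂ] E :=
  propagator H (-t) ∘L A ∘L propagator H t

/-- `R` is the resolvent `(K - z)⁻¹`: a bounded, everywhere defined, two-sided inverse of
`K - z : D(K) → E`. (Its existence says that `z` is in the resolvent set of `K`, and implies that
`K` is closed.) -/
def IsResolventAt (K : E →ₗ.[ℂ] E) (z : ℂ) (R : E →L[ℂ] E) : Prop :=
  (∀ ψ : K.domain, R (K ψ - z • (ψ : E)) = ψ) ∧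
    ∀ φ : E, ∃ h : R φ ∈ K.domain, K ⟨R φ, h⟩ - z • R φ = φ

/-- The family `ζ ↦ K_ζ` is analytic at `ζ₀` in the sense of Kato: there is a number `z` such that,
for all `ζ` near `ζ₀`, `z` is in the resolvent set of `K_ζ`, and the resolvent `(K_ζ - z)⁻¹` is an
analytic function of `ζ` near `ζ₀`, with values in the bounded operators. -/
def KatoAnalyticAt {n : ℕ} (K : (Fin n → ℂ) → E →ₗ.[ℂ] E) (ζ₀ : Fin n → ℂ) : Prop :=
  ∃ (z : ℂ) (R : (Fin n → ℂ) → E →L[ℂ] E),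
    (∀ᶠ ζ in 𝓝 ζ₀, IsResolventAt (K ζ) z (R ζ)) ∧ AnalyticAt ℂ R ζ₀

/-- `(1/2i)(K - K*)` is the bounded operator `M`: `K` is densely defined, `D(K) ⊆ D(K*)`, and
`Kψ - K*ψ = 2i Mψ` for all `ψ ∈ D(K)`. (As `D(K)` is dense, `M` is unique.) -/
def HasBoundedImaginaryPart (K : E →ₗ.[ℂ] E) (M : E →L[ℂ] E) : Prop :=
  Dense (K.domain : Set E) ∧
    ∀ ψ : K.domain, ∃ h : (ψ : E) ∈ K.adjoint.domain,
      K ψ - K.adjoint ⟨ψ, h⟩ = (2 * Complex.I) • M ψ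

end Unbounded

/-! ### The analyticity condition -/

/-- The polystrip `S_aⁿ = {ζ ∈ ℂⁿ : |Im ζ_j| < a for all j}`. -/
def polystrip (n : ℕ) (a : ℝ) : Set (Fin n → ℂ) := {ζ | ∀ j, |(ζ j).im| < a}

/-- Condition (A) with parameter `a`: the family `H_ξ = T_ξ H T_ξ⁻¹`, `ξ ∈ ℝⁿ`, has a continuation
`ζ ↦ K_ζ` to the polystrip `S_aⁿ` that is analytic in the sense of Kato, and the operators
`Im K_ζ = (1/2i)(K_ζ - K_ζ*)` are bounded, uniformly on every smaller polystrip. -/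
def ConditionA {n : ℕ} (H : L2 n →ₗ.[ℂ] L2 n) (a : ℝ) : Prop :=
  ∃ (K : (Fin n → ℂ) → L2 n →ₗ.[ℂ] L2 n) (M : (Fin n → ℂ) → L2 n →L[ℂ] L2 n),
    (∀ ξ : Space n, K (fun j => ((ξ j : ℝ) : ℂ)) = sandwich (T ξ) H (T (-ξ))) ∧
    (∀ ζ ∈ polystrip n a, KatoAnalyticAt K ζ) ∧
    (∀ ζ ∈ polystrip n a, HasBoundedImaginaryPart (K ζ) (M ζ)) ∧
    ∀ a' < a, ∃ b : ℝ, ∀ ζ ∈ polystrip n a', ‖M ζ‖ ≤ b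

end LiebRobinson

end

/-!
# The quantum-mechanical Lieb–Robinson bound

Since `A - 1 = χ_X (A - 1) χ_X` and `B - 1 = χ_Y (B - 1) χ_Y`, the commutator `[α_t(A), B]` is
controlled by `‖χ_X e^{-itH} χ_Y‖` and `‖χ_Y e^{itH} χ_X‖` (`norm_mul_comm_sub_le`), so that the
theorem is a statement on the exponential decay of the propagator between separated sets.

For bounded sets `P`, `Q` and a vector `v` with `‖v‖ ≤ 1`, the decay comes from an estimate of `e^{μ
v·x} e^{-itH} e^{-μ v·x}`, the translate of the propagator by the imaginary vector `iμv`, by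
`e^{b|t|}`, where `b` is a bound of `‖Im H_ζ‖` on a polystrip. The complex translate of the
propagator itself is never constructed. By the exponential formula (`IsUnitaryGroupOf.tendsto_pow`),
`e^{-itH}` is the strong limit of the powers `(1 + itH/m)^{-m}`, which are multiples of powers of
resolvents. For `|Im w| > b` the translated resolvents `T_{sv} (H - w)⁻¹ T_{-sv}` continue from real
`s` to a strip, with norm at most `1 / (|Im w| - b)` (`exists_analytic_resolvent`): Kato analyticity
gives only some resolvent point near each parameter, but the set of the parameters with `w` in the
resolvent set is open and, by the uniform bound from the numerical range, relatively closed. After a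
cut-off to `P` and `Q` the weights `e^{s v·x}` are entire operator-valued functions, and the
identity theorem (`mul_mul_eq_of_analyticOnNhd`) identifies the continuation at `s = iμ` with the
exponentially weighted resolvent power. As `m → ∞`, the bounds `(1 - b|t|/m)^{-m}` tend to
`e^{b|t|}`.

General sets `X`, `Y` are cut into cubes. Each pair of cubes gets its own direction `v`, and the
blocks are summed by a Schur test (`norm_le_of_schur`). The decay rate of the blocks is `μ' = (a +
μ) / 2`, and the cubes have side `ℓ = 1 / (μ' - μ)`, so that the surplus of `μ'` over `μ` yields the
summable factor `e^{-|j - k|}`. This costs a constant depending on `n` and on `(a + μ) / (a - μ)`,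
and the latter is bounded by the number `c` of the theorem.

Stone's theorem (`exists_isUnitaryGroupOf`) is proved by bounded approximation of `H`; it ensures
that the propagator is the unitary group generated by `-iH`.
-/

noncomputable section

namespace LiebRobinson

/-! ### Resolvents of unbounded operators -/

section Resolvent

variable {E : Type*} [NormedAddCommGroup E] [InnerProductSpace ℂ E]

namespace IsResolventAt

variable {K : E →ₗ.[ℂ] E} {z w : ℂ} {R R' : E →L[ℂ] E}

theorem apply_mem (h : IsResolventAt K z R) (φ : E) : R φ ∈ K.domain := (h.2 φ).1

theorem map_apply (h : IsResolventAt K z R) (φ : E) (hm : R φ ∈ K.domain) :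
    K ⟨R φ, hm⟩ = z • R φ + φ := by
  obtain ⟨_, h2⟩ := h.2 φ
  rw [← sub_eq_iff_eq_add', h2]

theorem eq_of_sub (h : IsResolventAt K z R) (ψ : K.domain) {φ : E} (hψ : K ψ - z • (ψ : E) = φ) :
    R φ = ψ := by
  rw [← hψ, h.1]

theorem unique (h : IsResolventAt K z R) (h' : IsResolventAt K z R') : R = R' := by
  ext φ
  obtain ⟨hm, h2⟩ := h'.2 φ
  exact h.eq_of_sub ⟨_, hm⟩ h2

/-- The first resolvent identity. -/
theorem sub_eq (h : IsResolventAt K z R) (h' : IsResolventAt K w R') :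
    R - R' = (z - w) • (R * R') := by
  ext φ
  have hm := h'.apply_mem φ
  have := h.eq_of_sub ⟨_, hm⟩ (φ := φ - (z - w) • R' φ) (by rw [h'.map_apply]; module)
  simp only [map_sub, map_smul] at this
  simp only [sub_apply, smul_apply, mul_apply_eq_comp]
  rw [← sub_eq_zero, ← sub_eq_zero.2 this]
  abel

theorem commute (h : IsResolventAt K z R) (h' : IsResolventAt K w R') : Commute R R' := by
  by_cases hzw : z = w
  · subst hzw
    rw [h.unique h']
  · have h1 := h.sub_eq h'
    have h2 := h'.sub_eq h
    have : (z - w) • (R * R') = (z - w) • (R' * R) := by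
      rw [← h1, ← neg_sub, h2, ← neg_smul, neg_sub]
    exact smul_right_injective _ (sub_ne_zero.2 hzw) this

/-- If `1 + (z - w) (K - z)⁻¹` is invertible, then `w` is in the resolvent set. -/
theorem of_inverse (h : IsResolventAt K z R) {S : E →L[ℂ] E} (h1 : S * (1 + (z - w) • R) = 1)
    (h2 : (1 + (z - w) • R) * S = 1) : IsResolventAt K w (R * S) := by
  constructor
  · intro ψ
    have e : K ψ - w • (ψ : E) = (1 + (z - w) • R) (K ψ - z • (ψ : E)) := by
      simp only [add_apply, one_apply_eq_self, smul_apply, h.1 ψ]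
      module
    have : S (K ψ - w • (ψ : E)) = K ψ - z • (ψ : E) := by
      rw [e, ← mul_apply_eq_comp, h1, one_apply_eq_self]
    rw [mul_apply_eq_comp, this, h.1]
  · intro φ
    refine ⟨h.apply_mem _, ?_⟩
    have := congr($h2 φ)
    simp only [mul_apply_eq_comp, add_apply, one_apply_eq_self,
      smul_apply] at this
    have e := h.map_apply (S φ) (h.apply_mem _)
    change K ⟨R (S φ), h.apply_mem _⟩ - w • R (S φ) = φ
    rw [e]
    rw [← sub_eq_zero, ← sub_eq_zero.2 this]
    module

/-- If both `z` and `w` are in the resolvent set, then `1 + (z - w) (K - z)⁻¹` is invertible, with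
inverse `1 + (w - z) (K - w)⁻¹`. -/
def unit (h : IsResolventAt K z R) (h' : IsResolventAt K w R') : (E →L[ℂ] E)ˣ where
  val := 1 + (z - w) • R
  inv := 1 + (w - z) • R'
  val_inv := by
    have := h.sub_eq h'
    have e : (1 + (z - w) • R) * (1 + (w - z) • R') =
        1 + (z - w) • (R - R' - (z - w) • (R * R')) := by
      simp only [add_mul, mul_add, one_mul, mul_one, smul_mul_assoc, mul_smul_comm]
      module
    rw [e, this, sub_self, smul_zero, add_zero]
  inv_val := by
    have := h'.sub_eq h
    have e : (1 + (w - z) • R') * (1 + (z - w) • R) =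
        1 + (w - z) • (R' - R - (w - z) • (R' * R)) := by
      simp only [add_mul, mul_add, one_mul, mul_one, smul_mul_assoc, mul_smul_comm]
      module
    rw [e, this, sub_self, smul_zero, add_zero]

/-- An operator whose numerical range lies in the strip `|Im z| ≤ b` satisfies
`‖(K - w)⁻¹‖ ≤ 1 / (|Im w| - b)` at the points `w` of its resolvent set outside this strip. -/
theorem norm_le (h : IsResolventAt K w R) {b : ℝ}
    (hb : ∀ ψ : K.domain, |(inner ℂ (ψ : E) (K ψ)).im| ≤ b * ‖(ψ : E)‖ ^ 2) (hw : b < |w.im|) :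
    ‖R‖ ≤ (|w.im| - b)⁻¹ := by
  have hpos : 0 < |w.im| - b := sub_pos.2 hw
  refine R.opNorm_le_bound (inv_nonneg.2 hpos.le) fun φ => ?_
  rw [inv_mul_eq_div, le_div_iff₀ hpos]
  have hm := h.apply_mem φ
  have hφ : φ = K ⟨R φ, hm⟩ - w • R φ := by rw [h.map_apply]; abel
  set χ : E := R φ
  have e : (inner ℂ χ φ).im = (inner ℂ χ (K ⟨χ, hm⟩)).im - w.im * ‖χ‖ ^ 2 := by
    rw [hφ, inner_sub_right, inner_smul_right, inner_self_eq_norm_sq_to_K, Complex.sub_im]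
    congr 1
    simp [← Complex.ofReal_pow]
  have h1 : |(inner ℂ χ φ).im| ≤ ‖χ‖ * ‖φ‖ :=
    (Complex.abs_im_le_norm _).trans (norm_inner_le_norm _ _)
  have h2 := hb ⟨χ, hm⟩
  have h3 : |w.im| * ‖χ‖ ^ 2 ≤ b * ‖χ‖ ^ 2 + ‖χ‖ * ‖φ‖ := by
    have : w.im * ‖χ‖ ^ 2 = (inner ℂ χ (K ⟨χ, hm⟩)).im - (inner ℂ χ φ).im := by rw [e]; ring
    calc |w.im| * ‖χ‖ ^ 2 = |w.im * ‖χ‖ ^ 2| := by rw [abs_mul, abs_of_nonneg (sq_nonneg ‖χ‖)]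
      _ ≤ _ := by
        rw [this]
        exact (abs_sub _ _).trans (add_le_add h2 h1)
  rcases (norm_nonneg χ).eq_or_lt with h0 | h0
  · rw [← h0]; simp
  · refine le_of_mul_le_mul_left ?_ h0
    nlinarith

end IsResolventAt

/-- The resolvent is carried along a similarity of the operator. -/
theorem IsResolventAt.sandwich [CompleteSpace E] {H : E →ₗ.[ℂ] E} {z : ℂ} {R S S' : E →L[ℂ] E}
    (h : IsResolventAt H z R) (h1 : S * S' = 1) (h2 : S' * S = 1) :
    IsResolventAt (sandwich S H S') z (S * R * S') := by
  have e1 (x : E) : S (S' x) = x := congr($h1 x)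
  have e2 (x : E) : S' (S x) = x := congr($h2 x)
  constructor
  · intro ψ
    have hs : LiebRobinson.sandwich S H S' ψ = S (H ⟨S' ψ, ψ.2⟩) := rfl
    rw [hs]
    simp only [mul_apply_eq_comp, map_sub, map_smul, e2]
    rw [← map_smul, ← map_sub, ← map_smul, ← map_sub, h.1 ⟨S' ψ, ψ.2⟩, e1]
  · intro φ
    have hm : S' ((S * R * S') φ) ∈ H.domain := by
      simp only [mul_apply_eq_comp, e2]
      exact h.apply_mem _
    refine ⟨hm, ?_⟩
    have hs : LiebRobinson.sandwich S H S' ⟨(S * R * S') φ, hm⟩ =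
      S (H ⟨S' ((S * R * S') φ), hm⟩) := rfl
    rw [hs]
    have : (⟨S' ((S * R * S') φ), hm⟩ : H.domain) = ⟨R (S' φ), h.apply_mem _⟩ := by
      ext
      simp only [mul_apply_eq_comp, e2]
    rw [this, h.map_apply]
    simp [e1]

/-- Elements close to an invertible `u`, in terms of `‖u⁻¹‖`, are invertible. In particular a limit
of invertible elements with bounded inverses is invertible. -/
theorem isUnit_of_norm_sub_mul_lt {A : Type*} [NormedRing A] [CompleteSpace A] (u : Aˣ) {x : A}
    (h : ‖x - u‖ * ‖((u⁻¹ : Aˣ) : A)‖ < 1) : IsUnit x := by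
  have h1 : ‖((u⁻¹ : Aˣ) : A) * (u - x)‖ < 1 := by
    refine (norm_mul_le _ _).trans_lt ?_
    rw [mul_comm, ← norm_neg (_ - _), neg_sub]
    exact h
  have : x = u * (Units.oneSub _ h1 : Aˣ) := by
    rw [Units.val_oneSub, mul_sub, mul_one, ← mul_assoc, Units.mul_inv, one_mul, sub_sub_cancel]
  rw [this, ← Units.val_mul]
  exact Units.isUnit _

end Resolvent

section Continuation

variable {E : Type*} [NormedAddCommGroup E] [InnerProductSpace ℂ E] [CompleteSpace E]

/-- Resolvents of an analytic family continue along the parameter: if the numerical ranges of all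
`K s`, `s ∈ D`, lie in the strip `|Im z| ≤ b`, then a number `w` outside this strip that is in the
resolvent set of one `K s` is in the resolvent set of all of them, and `(K s - w)⁻¹` is analytic.
The set of the good parameters is open since invertibility is an open condition, and relatively
closed since the resolvents at `w` are uniformly bounded. -/
theorem exists_analytic_resolvent {K : ℂ → E →ₗ.[ℂ] E} {D : Set ℂ} (hD : IsOpen D)
    (hDc : IsPreconnected D)
    (hK : ∀ s ∈ D, ∃ (z : ℂ) (R : ℂ → E →L[ℂ] E),
      (∀ᶠ s' in 𝓝 s, IsResolventAt (K s') z (R s')) ∧ AnalyticAt ℂ R s)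
    {b : ℝ} (hb : ∀ s ∈ D, ∀ ψ : (K s).domain,
      |(inner ℂ (ψ : E) (K s ψ)).im| ≤ b * ‖(ψ : E)‖ ^ 2)
    {w : ℂ} (hw : b < |w.im|) {s₀ : ℂ} (hs₀ : s₀ ∈ D) {R₀ : E →L[ℂ] E}
    (hR₀ : IsResolventAt (K s₀) w R₀) :
    ∃ R : ℂ → E →L[ℂ] E, (∀ s ∈ D, IsResolventAt (K s) w (R s)) ∧ AnalyticOnNhd ℂ R D := by
  set G : Set ℂ := {s | s ∈ D ∧ ∃ R, IsResolventAt (K s) w R} with hG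
  -- Near a point of invertibility the resolvent at `w` is an analytic function.
  have key : ∀ s ∈ D, ∀ (z : ℂ) (R : ℂ → E →L[ℂ] E),
      (∀ᶠ s' in 𝓝 s, IsResolventAt (K s') z (R s')) → AnalyticAt ℂ R s →
      IsUnit (1 + (z - w) • R s) → ∃ R' : ℂ → E →L[ℂ] E,
        (∀ᶠ s' in 𝓝 s, IsResolventAt (K s') w (R' s')) ∧ AnalyticAt ℂ R' s := by
    intro s _ z R hR hRa hu
    have hA : AnalyticAt ℂ (fun s' => 1 + (z - w) • R s') s :=
      analyticAt_const.add (analyticAt_const.fun_smul hRa)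
    obtain ⟨u, hu⟩ := hu
    have hinv : AnalyticAt ℂ (fun s' => Ring.inverse (1 + (z - w) • R s')) s := by
      have := analyticAt_inverse (𝕜 := ℂ) u
      rw [hu] at this
      exact AnalyticAt.comp (g := Ring.inverse) (f := fun s' => 1 + (z - w) • R s') this hA
    refine ⟨fun s' => R s' * Ring.inverse (1 + (z - w) • R s'), ?_, hRa.fun_mul hinv⟩
    have hev : ∀ᶠ s' in 𝓝 s, IsUnit (1 + (z - w) • R s') := by
      have := Units.nhds u
      rw [hu] at this
      exact hA.continuousAt.eventually this
    filter_upwards [hR, hev] with s' h1 h2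
    exact h1.of_inverse (Ring.inverse_mul_cancel _ h2) (Ring.mul_inverse_cancel _ h2)
  have hloc : ∀ s ∈ G, ∃ R' : ℂ → E →L[ℂ] E,
      (∀ᶠ s' in 𝓝 s, IsResolventAt (K s') w (R' s')) ∧ AnalyticAt ℂ R' s := by
    rintro s ⟨hs, R', hR'⟩
    obtain ⟨z, R, hR, hRa⟩ := hK s hs
    exact key s hs z R hR hRa ((hR.self_of_nhds).unit hR').isUnit
  have hGo : IsOpen G := by
    rw [isOpen_iff_mem_nhds]
    intro s hs
    obtain ⟨R', hR', -⟩ := hloc s hs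
    filter_upwards [hR', hD.mem_nhds hs.1] with s' h1 h2
    exact ⟨h2, _, h1⟩
  have hGc : closure G ∩ D ⊆ G := by
    rintro s ⟨hs, hsD⟩
    obtain ⟨z, R, hR, hRa⟩ := hK s hsD
    set N : ℝ := 1 + ‖w - z‖ * (|w.im| - b)⁻¹ with hN
    have hNpos : 0 < N := by
      have := inv_nonneg.2 (sub_pos.2 hw).le
      positivity
    have hc : Tendsto (fun s' => ‖(1 + (z - w) • R s) - (1 + (z - w) • R s')‖ * N) (𝓝 s)
        (𝓝 (‖(1 + (z - w) • R s) - (1 + (z - w) • R s)‖ * N)) := by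
      have := hRa.continuousAt
      apply ContinuousAt.tendsto
      fun_prop
    rw [sub_self, norm_zero, zero_mul] at hc
    have hev := (hc.eventually (gt_mem_nhds one_pos)).and hR
    obtain ⟨s', ⟨hs'D, R', hR'⟩, h1, h2⟩ :=
      ((mem_closure_iff_frequently.1 hs).and_eventually hev).exists
    have hu : IsUnit (1 + (z - w) • R s) := by
      refine isUnit_of_norm_sub_mul_lt (h2.unit hR') (lt_of_le_of_lt ?_ h1)
      refine mul_le_mul_of_nonneg_left ?_ (norm_nonneg _)
      change ‖1 + (w - z) • R'‖ ≤ N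
      refine (norm_add_le _ _).trans (add_le_add ContinuousLinearMap.norm_id_le ?_)
      rw [norm_smul]
      exact mul_le_mul_of_nonneg_left (hR'.norm_le (hb s' hs'D) hw) (norm_nonneg _)
    obtain ⟨R'', hR'', -⟩ := key s hsD z R hR hRa hu
    exact ⟨hsD, _, hR''.self_of_nhds⟩
  have hDG : D ⊆ G := hDc.subset_of_closure_inter_subset hGo ⟨s₀, hs₀, hs₀, R₀, hR₀⟩ hGc
  have hex : ∀ s ∈ D, ∃ R, IsResolventAt (K s) w R := fun s hs => (hDG hs).2
  choose! R hR using hex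
  refine ⟨R, hR, fun s hs => ?_⟩
  obtain ⟨R', hR', hR'a⟩ := hloc s (hDG hs)
  refine hR'a.congr ?_
  filter_upwards [hR', hD.mem_nhds hs] with s' h1 h2
  exact h1.unique (hR s' h2)

end Continuation

/-! ### Self-adjoint operators and their resolvents -/

section SelfAdjoint

variable {E : Type*} [NormedAddCommGroup E] [InnerProductSpace ℂ E]
variable {H : E →ₗ.[ℂ] E}

theorem inner_map_left_of_isSelfAdjoint [CompleteSpace E] (hH : IsSelfAdjoint H) (ψ χ : H.domain) :
    inner ℂ (H ψ) (χ : E) = inner ℂ (ψ : E) (H χ) := by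
  have := H.adjoint_isFormalAdjoint hH.dense_domain
  rw [LinearPMap.isSelfAdjoint_def.1 hH] at this
  exact this ψ χ

theorem mem_graph_of_forall_inner [CompleteSpace E] (hH : IsSelfAdjoint H) {ψ φ : E}
    (h : ∀ χ : H.domain, inner ℂ φ (χ : E) = inner ℂ ψ (H χ)) : (ψ, φ) ∈ H.graph := by
  have hm := H.mem_adjoint_domain_of_exists ψ ⟨φ, h⟩
  have : (ψ, φ) ∈ H.adjoint.graph :=
    H.adjoint.mem_graph_iff.2 ⟨⟨ψ, hm⟩, rfl, LinearPMap.adjoint_apply_eq hH.dense_domain _ h⟩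
  rwa [LinearPMap.isSelfAdjoint_def.1 hH] at this

theorem inner_map_self_im_of_isSelfAdjoint [CompleteSpace E] (hH : IsSelfAdjoint H) (ψ : H.domain) :
    (inner ℂ (ψ : E) (H ψ)).im = 0 := by
  have h := inner_map_left_of_isSelfAdjoint hH ψ ψ
  rw [← inner_conj_symm] at h
  exact Complex.conj_eq_iff_im.1 h

theorem IsResolventAt.norm_le_of_isSelfAdjoint [CompleteSpace E] (hH : IsSelfAdjoint H) {w : ℂ}
    {R : E →L[ℂ] E}
    (h : IsResolventAt H w R) (hw : w.im ≠ 0) : ‖R‖ ≤ |w.im|⁻¹ := by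
  have := h.norm_le (b := 0) (fun ψ => by simp [inner_map_self_im_of_isSelfAdjoint hH ψ])
    (abs_pos.2 hw)
  rwa [sub_zero] at this

theorem abs_im_mul_norm_le [CompleteSpace E] (hH : IsSelfAdjoint H) (w : ℂ) (ψ : H.domain) :
    |w.im| * ‖(ψ : E)‖ ≤ ‖H ψ - w • (ψ : E)‖ := by
  have e : (inner ℂ (ψ : E) (H ψ - w • (ψ : E))).im = - (w.im * ‖(ψ : E)‖ ^ 2) := by
    rw [inner_sub_right, inner_smul_right, inner_self_eq_norm_sq_to_K, Complex.sub_im,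
      inner_map_self_im_of_isSelfAdjoint hH]
    simp [← Complex.ofReal_pow]
  have h1 : |(inner ℂ (ψ : E) (H ψ - w • (ψ : E))).im| ≤ ‖(ψ : E)‖ * ‖H ψ - w • (ψ : E)‖ :=
    (Complex.abs_im_le_norm _).trans (norm_inner_le_norm _ _)
  rw [e, abs_neg, abs_mul, abs_of_nonneg (sq_nonneg ‖(ψ : E)‖)] at h1
  rcases (norm_nonneg (ψ : E)).eq_or_lt with h0 | h0
  · rw [← h0]; simp
  · refine le_of_mul_le_mul_left ?_ h0
    nlinarith

/-- Every non-real number is in the resolvent set of a self-adjoint operator: `H - w` is bounded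
below on the (complete) graph of `H`, and the orthogonal complement of its range is the kernel of
`H - w̄`, which is trivial. -/
theorem exists_isResolventAt [CompleteSpace E] (hH : IsSelfAdjoint H) {w : ℂ} (hw : w.im ≠ 0) :
    ∃ R : E →L[ℂ] E, IsResolventAt H w R := by
  have hwpos : 0 < |w.im| := abs_pos.2 hw
  have hcl : IsClosed (H.graph : Set (E × E)) := hH.isClosed
  have : CompleteSpace H.graph := hcl.completeSpace_coe
  let f : H.graph →L[ℂ] E :=
    (ContinuousLinearMap.snd ℂ E E - w • ContinuousLinearMap.fst ℂ E E) ∘L H.graph.subtypeL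
  have hf (ψ : H.domain) (hm : ((ψ : E), H ψ) ∈ H.graph) :
      f ⟨((ψ : E), H ψ), hm⟩ = H ψ - w • (ψ : E) := rfl
  have hbound : ∀ p : H.graph, ‖p‖ ≤ (1 + (1 + ‖w‖) * |w.im|⁻¹) * ‖f p‖ := by
    rintro ⟨⟨x, y⟩, hp⟩
    obtain ⟨ψ, h1, h2⟩ := H.mem_graph_iff.1 hp
    dsimp only at h1 h2
    subst h1 h2
    rw [hf]
    have h3 : ‖(ψ : E)‖ ≤ |w.im|⁻¹ * ‖H ψ - w • (ψ : E)‖ := by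
      rw [inv_mul_eq_div, le_div_iff₀ hwpos, mul_comm]
      exact abs_im_mul_norm_le hH w ψ
    have h4 : ‖H ψ‖ ≤ ‖H ψ - w • (ψ : E)‖ + ‖w‖ * ‖(ψ : E)‖ := by
      rw [← norm_smul]
      simpa using norm_add_le (H ψ - w • (ψ : E)) (w • (ψ : E))
    have h5 := mul_le_mul_of_nonneg_left h3 (norm_nonneg w)
    have h6 : 0 ≤ |w.im|⁻¹ * ‖H ψ - w • (ψ : E)‖ := by positivity
    have h7 : 0 ≤ ‖w‖ * (|w.im|⁻¹ * ‖H ψ - w • (ψ : E)‖) := by positivity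
    have h8 := norm_nonneg (H ψ - w • (ψ : E))
    change max ‖(ψ : E)‖ ‖H ψ‖ ≤ _
    refine max_le ?_ ?_ <;> nlinarith
  have hanti : AntilipschitzWith (1 + (1 + ‖w‖) * |w.im|⁻¹).toNNReal f := by
    refine AddMonoidHomClass.antilipschitz_of_bound f fun p => ?_
    rw [Real.coe_toNNReal _ (by positivity)]
    exact hbound p
  have hrc : IsClosed (f.range : Set E) := by
    rw [LinearMap.coe_range]
    exact hanti.isClosed_range f.uniformContinuous
  have hker : f.ker = ⊥ := LinearMap.ker_eq_bot.2 hanti.injective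
  have hran : f.range = ⊤ := by
    have : CompleteSpace f.range := hrc.completeSpace_coe
    rw [← Submodule.orthogonal_eq_bot_iff, Submodule.eq_bot_iff]
    intro φ hφ
    have h1 : ∀ χ : H.domain, inner ℂ ((starRingEnd ℂ w) • φ) (χ : E) = inner ℂ φ (H χ) := by
      intro χ
      have h2 : f ⟨((χ : E), H χ), H.mem_graph χ⟩ ∈ f.range := ⟨_, rfl⟩
      have h3 := (Submodule.mem_orthogonal' _ _).1 hφ _ h2
      rw [hf, inner_sub_right, inner_smul_right, sub_eq_zero] at h3
      rw [h3, inner_smul_left, starRingEnd_self_apply]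
    obtain ⟨ψ, h2, h3⟩ := H.mem_graph_iff.1 (mem_graph_of_forall_inner hH h1)
    dsimp only at h2 h3
    have h4 := abs_im_mul_norm_le hH (starRingEnd ℂ w) ψ
    rw [h3, h2, sub_self, norm_zero, Complex.conj_im, abs_neg] at h4
    exact norm_le_zero_iff.1 (nonpos_of_mul_nonpos_right h4 hwpos)
  let e := ContinuousLinearEquiv.ofBijective f hker hran
  refine ⟨ContinuousLinearMap.fst ℂ E E ∘L H.graph.subtypeL ∘L (e.symm : E →L[ℂ] H.graph),
    fun ψ => ?_, fun φ => ?_⟩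
  · have h1 : e.symm (H ψ - w • (ψ : E)) = ⟨((ψ : E), H ψ), H.mem_graph ψ⟩ := by
      rw [ContinuousLinearEquiv.symm_apply_eq]
      rfl
    simp [h1]
  · obtain ⟨ψ, h2, h3⟩ := H.mem_graph_iff.1 (e.symm φ).2
    have h1 : f (e.symm φ) = φ := e.apply_symm_apply φ
    have h4 : (e.symm φ : E × E).2 - w • (e.symm φ : E × E).1 = φ := h1
    rw [← h3, ← h2] at h4
    have h5 : (e.symm φ : E × E).1 ∈ H.domain := h2 ▸ ψ.2
    refine ⟨h5, ?_⟩
    change H ⟨(e.symm φ : E × E).1, h5⟩ - w • (e.symm φ : E × E).1 = φ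
    have h6 : (⟨(e.symm φ : E × E).1, h5⟩ : H.domain) = ψ := Subtype.ext h2.symm
    rw [h6, ← h2, h4]

theorem IsResolventAt.inner_left [CompleteSpace E] (hH : IsSelfAdjoint H) {w : ℂ} {R R' : E →L[ℂ] E}
    (h : IsResolventAt H w R) (h' : IsResolventAt H (starRingEnd ℂ w) R') (φ χ : E) :
    inner ℂ (R φ) χ = inner ℂ φ (R' χ) := by
  have e1 := h.map_apply φ (h.apply_mem φ)
  have e2 := h'.map_apply χ (h'.apply_mem χ)
  have e3 := inner_map_left_of_isSelfAdjoint hH ⟨R φ, h.apply_mem φ⟩ ⟨R' χ, h'.apply_mem χ⟩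
  rw [e1, e2] at e3
  simp only [inner_add_left, inner_add_right, inner_smul_left, inner_smul_right] at e3
  exact (add_left_cancel e3).symm

/-! ### The regularizers `(1 + i H / κ)⁻¹` -/

/-- A sequence of contractions that converges strongly on a dense set to a bounded operator
converges strongly everywhere. -/
theorem tendsto_apply_of_dense {ι : Type*} {l : Filter ι} {A : ι → E →L[ℂ] E} {B : E →L[ℂ] E}
    (hA : ∀ i, ‖A i‖ ≤ 1) {s : Set E} (hs : Dense s)
    (h : ∀ ψ ∈ s, Tendsto (fun i => A i ψ) l (𝓝 (B ψ))) (ψ : E) :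
    Tendsto (fun i => A i ψ) l (𝓝 (B ψ)) := by
  rw [Metric.tendsto_nhds]
  intro ε hε
  have hC : 0 < 1 + ‖B‖ := by positivity
  obtain ⟨χ, hχ, hd⟩ := hs.exists_dist_lt ψ (ε := ε / 2 / (1 + ‖B‖)) (by positivity)
  filter_upwards [(Metric.tendsto_nhds.1 (h χ hχ)) (ε / 2) (by positivity)] with i hi
  rw [lt_div_iff₀ hC, dist_eq_norm] at hd
  rw [dist_eq_norm] at hi ⊢
  have e : A i ψ - B ψ = A i (ψ - χ) - B (ψ - χ) + (A i χ - B χ) := by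
    rw [map_sub, map_sub]; abel
  have h1 : ‖A i (ψ - χ)‖ ≤ 1 * ‖ψ - χ‖ := (A i).le_of_opNorm_le (hA i) _
  have h2 := B.le_opNorm (ψ - χ)
  calc ‖A i ψ - B ψ‖ ≤ ‖A i (ψ - χ)‖ + ‖B (ψ - χ)‖ + ‖A i χ - B χ‖ := by
        rw [e]
        exact (norm_add_le _ _).trans (add_le_add_left (norm_sub_le _ _) _)
    _ < ε := by nlinarith

theorem norm_smul_resolvent_le [CompleteSpace E] (hH : IsSelfAdjoint H) {κ : ℝ} (hκ : κ ≠ 0)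
    {R : E →L[ℂ] E} (hR : IsResolventAt H (κ * Complex.I) R) : ‖(-(κ * Complex.I)) • R‖ ≤ 1 := by
  have h := hR.norm_le_of_isSelfAdjoint hH (by simpa using hκ)
  rw [norm_smul]
  have h1 : ‖(-(κ * Complex.I) : ℂ)‖ = |κ| := by simp
  have h2 : |((κ : ℂ) * Complex.I).im| = |κ| := by simp
  rw [h2] at h
  rw [h1]
  calc |κ| * ‖R‖ ≤ |κ| * |κ|⁻¹ := mul_le_mul_of_nonneg_left h (abs_nonneg _)
    _ = 1 := mul_inv_cancel₀ (abs_ne_zero.2 hκ)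

/-- On the domain, `(1 + i H / κ)⁻¹ ψ - ψ = -(H - iκ)⁻¹ H ψ`. -/
theorem smul_resolvent_sub_self {κ : ℝ} {R : E →L[ℂ] E}
    (hR : IsResolventAt H (κ * Complex.I) R) (ψ : H.domain) :
    ((-(κ * Complex.I)) • R) (ψ : E) - ψ = -R (H ψ) := by
  have := hR.1 ψ
  rw [map_sub, map_smul] at this
  rw [smul_apply, ← sub_eq_zero, ← sub_eq_zero.2 this]
  module

/-- `(1 + i H / κ)⁻¹ → 1` strongly, as `|κ| → ∞`. -/
theorem tendsto_smul_resolvent [CompleteSpace E] (hH : IsSelfAdjoint H) {κ : ℕ → ℝ}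
    (hκ : ∀ m, κ m ≠ 0)
    (hκt : Tendsto (fun m => |κ m|⁻¹) atTop (𝓝 0)) {R : ℕ → E →L[ℂ] E}
    (hR : ∀ m, IsResolventAt H (κ m * Complex.I) (R m)) (ψ : E) :
    Tendsto (fun m => ((-(κ m * Complex.I)) • R m) ψ) atTop (𝓝 ψ) := by
  refine tendsto_apply_of_dense (B := 1) (fun m => norm_smul_resolvent_le hH (hκ m) (hR m))
    hH.dense_domain (fun ψ hψ => ?_) ψ
  rw [one_apply_eq_self, tendsto_iff_norm_sub_tendsto_zero]
  refine squeeze_zero (fun _ => norm_nonneg _) (fun m => ?_)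
    (by simpa using hκt.mul_const ‖H ⟨ψ, hψ⟩‖)
  have h1 := smul_resolvent_sub_self (hR m) ⟨ψ, hψ⟩
  dsimp only at h1
  rw [h1, norm_neg]
  refine (R m).le_of_opNorm_le ?_ _
  have h := (hR m).norm_le_of_isSelfAdjoint hH (by simpa using hκ m)
  simpa using h

/-! ### The exponential formula for unitary groups -/

namespace IsUnitaryGroupOf

variable {U : ℝ → E →L[ℂ] E}

theorem norm_le_one (hU : IsUnitaryGroupOf H U) (t : ℝ) : ‖U t‖ ≤ 1 :=
  (U t).opNorm_le_bound zero_le_one fun ψ => by rw [hU.norm_map, one_mul]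

theorem hasDerivAt (hU : IsUnitaryGroupOf H U) (ψ : H.domain) (t : ℝ) :
    HasDerivAt (fun s => U s (ψ : E)) (-(Complex.I • U t (H ψ))) t := by
  have h0 := (hU.mem_graph_iff ψ (H ψ)).1 (H.mem_graph ψ)
  have h1 := ((U t).restrictScalars ℝ).hasFDerivAt.comp_hasDerivAt (0 : ℝ) h0
  have h2 : HasDerivAt (fun s => s - t) 1 t := (hasDerivAt_id t).sub_const t
  have h3 := HasDerivAt.scomp_of_eq t h1 h2 (by simp)
  simp only [one_smul] at h3
  have e1 : ((U t).restrictScalars ℝ) (-(Complex.I • H ψ)) = -(Complex.I • U t (H ψ)) := by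
    simp
  rw [e1] at h3
  refine h3.congr_of_eventuallyEq (Eventually.of_forall fun s => ?_)
  change U s (ψ : E) = U t (U (s - t) ψ)
  rw [← ContinuousLinearMap.comp_apply, ← hU.map_add, add_sub_cancel]

theorem comm (hU : IsUnitaryGroupOf H U) (s t : ℝ) (ψ : E) : U s (U t ψ) = U t (U s ψ) := by
  rw [← ContinuousLinearMap.comp_apply, ← hU.map_add, add_comm, hU.map_add,
    ContinuousLinearMap.comp_apply]

theorem apply_mem_graph (hU : IsUnitaryGroupOf H U) (ψ : H.domain) (t : ℝ) :
    (U t (ψ : E), U t (H ψ)) ∈ H.graph := by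
  rw [hU.mem_graph_iff]
  have h0 := (hU.mem_graph_iff ψ (H ψ)).1 (H.mem_graph ψ)
  have h1 := ((U t).restrictScalars ℝ).hasFDerivAt.comp_hasDerivAt (0 : ℝ) h0
  have e1 : ((U t).restrictScalars ℝ) (-(Complex.I • H ψ)) = -(Complex.I • U t (H ψ)) := by
    simp
  rw [e1] at h1
  refine h1.congr_of_eventuallyEq (Eventually.of_forall fun s => ?_)
  exact hU.comm s t ψ

theorem commute_resolvent (hU : IsUnitaryGroupOf H U) {w : ℂ} {R : E →L[ℂ] E}
    (hR : IsResolventAt H w R) (t : ℝ) (φ : E) : R (U t φ) = U t (R φ) := by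
  obtain ⟨χ, h1, h2⟩ := H.mem_graph_iff.1 (hU.apply_mem_graph ⟨R φ, hR.apply_mem φ⟩ t)
  dsimp only at h1 h2
  rw [← h1]
  refine hR.eq_of_sub χ ?_
  rw [h1, h2, hR.map_apply, _root_.map_add, map_smul]
  abel

/-- One step of the implicit Euler scheme `(1 + iτH)⁻¹` agrees with `e^{-iτH}` to first order. -/
theorem norm_sub_smul_resolvent_le (hU : IsUnitaryGroupOf H U) {κ : ℝ} (hκ : κ ≠ 0)
    {R : E →L[ℂ] E} (hR : IsResolventAt H (κ * Complex.I) R) (ψ : H.domain) {ε : ℝ}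
    (hε : ∀ s : ℝ, |s| ≤ |κ⁻¹| → ‖U s (H ψ) - ((-(κ * Complex.I)) • R) (H ψ)‖ ≤ ε) :
    ‖U κ⁻¹ (ψ : E) - ((-(κ * Complex.I)) • R) (ψ : E)‖ ≤ ε * |κ⁻¹| := by
  set J := (-(κ * Complex.I)) • R with hJ
  let g : ℝ → E := fun s => U s (ψ : E) + s • (Complex.I • J (H ψ))
  have hg : ∀ s, HasDerivAt g (-(Complex.I • U s (H ψ)) + (Complex.I • J (H ψ))) s := fun s => by
    have := (hU.hasDerivAt ψ s).fun_add ((hasDerivAt_id s).smul_const (Complex.I • J (H ψ)))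
    simpa only [one_smul, id] using this
  have hmem (s : ℝ) (hs : s ∈ Set.uIcc 0 κ⁻¹) : |s| ≤ |κ⁻¹| := by
    simpa using Set.abs_sub_left_of_mem_uIcc hs
  have hmv := (convex_uIcc (0 : ℝ) κ⁻¹).norm_image_sub_le_of_norm_hasDerivWithin_le
    (fun s _ => (hg s).hasDerivWithinAt) (C := ε) (fun s hs => by
      have e : -(Complex.I • U s (H ψ)) + (Complex.I • J (H ψ)) =
        -(Complex.I • (U s (H ψ) - J (H ψ))) := by module
      rw [e, norm_neg, norm_smul, Complex.norm_I, one_mul]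
      exact hε s (hmem s hs)) Set.left_mem_uIcc Set.right_mem_uIcc
  rw [sub_zero, Real.norm_eq_abs] at hmv
  convert hmv using 2
  have h1 := smul_resolvent_sub_self hR ψ
  have h2 : κ⁻¹ • (Complex.I • J (H ψ)) = R (H ψ) := by
    rw [hJ, smul_apply, smul_smul, ← Complex.coe_smul, smul_smul]
    convert one_smul ℂ (R (H ψ)) using 2
    have : (κ : ℂ) ≠ 0 := by exact_mod_cast hκ
    push_cast
    field_simp
    rw [Complex.I_sq, neg_neg]
  rw [← hJ, sub_eq_iff_eq_add] at h1
  simp only [g, hU.map_zero, one_apply_eq_self, zero_smul, add_zero, h2, h1]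
  abel

/-- The exponential formula `e^{-itH} = lim (1 + itH/m)^{-m}`. -/
theorem tendsto_pow [CompleteSpace E] (hH : IsSelfAdjoint H) (hU : IsUnitaryGroupOf H U) {t : ℝ}
    (ht : t ≠ 0)
    {κ : ℕ → ℝ} (hκ : ∀ m, κ m = (m + 1 : ℕ) / t) {R : ℕ → E →L[ℂ] E}
    (hR : ∀ m, IsResolventAt H (κ m * Complex.I) (R m)) (ψ : E) :
    Tendsto (fun m => (((-(κ m * Complex.I)) • R m) ^ (m + 1)) ψ) atTop (𝓝 (U t ψ)) := by
  set J : ℕ → E →L[ℂ] E := fun m => (-(κ m * Complex.I)) • R m with hJ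
  have hκ0 (m : ℕ) : κ m ≠ 0 := by
    rw [hκ]; exact div_ne_zero (by exact_mod_cast m.succ_ne_zero) ht
  have hκt : Tendsto (fun m => |κ m|⁻¹) atTop (𝓝 0) := by
    have h1 : Tendsto (fun m : ℕ => |t| * (1 / ((m : ℝ) + 1))) atTop (𝓝 (|t| * 0)) :=
      tendsto_one_div_add_atTop_nhds_zero_nat.const_mul _
    rw [mul_zero] at h1
    refine h1.congr fun m => ?_
    rw [hκ, abs_div, inv_div, Nat.abs_cast]
    push_cast
    ring
  have hJ1 (m : ℕ) : ‖J m‖ ≤ 1 := norm_smul_resolvent_le hH (hκ0 m) (hR m)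
  have hJk (m k : ℕ) : ‖J m ^ k‖ ≤ 1 := by
    rcases k.eq_zero_or_pos with rfl | hk
    · exact (pow_zero (J m)).symm ▸ ContinuousLinearMap.norm_id_le
    · exact (norm_pow_le' _ hk).trans (pow_le_one₀ (norm_nonneg _) (hJ1 m))
  have hcomm (m k : ℕ) (s : ℝ) (φ : E) : (J m ^ k) (U s φ) = U s ((J m ^ k) φ) := by
    induction k generalizing φ with
    | zero => simp
    | succ k ih =>
      rw [pow_succ, mul_apply_eq_comp, mul_apply_eq_comp, ← ih]
      congr 1
      simp only [hJ, smul_apply, map_smul, hU.commute_resolvent (hR m)]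
  refine tendsto_apply_of_dense (fun m => hJk m _) hH.dense_domain (fun ψ hψ => ?_) ψ
  set χ := H ⟨ψ, hψ⟩ with hχ
  rw [Metric.tendsto_atTop]
  intro ε hε
  set δ := ε / 2 / (|t| + 1) with hδ
  have hδ0 : 0 < δ := by positivity
  obtain ⟨r, hr, hr'⟩ := Metric.tendsto_nhds_nhds.1 ((hU.continuous χ).tendsto 0) (δ / 2)
    (by positivity)
  have hev1 := hκt.eventually (gt_mem_nhds hr)
  have hev2 := Metric.tendsto_nhds.1 (tendsto_smul_resolvent hH hκ0 hκt hR χ) (δ / 2)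
    (by positivity)
  obtain ⟨N, hN⟩ := eventually_atTop.1 (hev1.and hev2)
  refine ⟨N, fun m hm => ?_⟩
  obtain ⟨h1, h2⟩ := hN m hm
  have hstep : ‖U (κ m)⁻¹ ψ - J m ψ‖ ≤ δ * |(κ m)⁻¹| := by
    refine hU.norm_sub_smul_resolvent_le (hκ0 m) (hR m) ⟨ψ, hψ⟩ fun s hs => ?_
    have h3 := hr' (x := s) (by
      rw [dist_zero_right, Real.norm_eq_abs]
      exact hs.trans_lt (by rwa [abs_inv]))
    rw [hU.map_zero, one_apply_eq_self] at h3
    have h4 := dist_triangle_right (U s χ) (J m χ) χ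
    rw [← dist_eq_norm]
    change dist (U s χ) (J m χ) ≤ δ
    change dist (J m χ) χ < δ / 2 at h2
    linarith
  -- the errors of the single steps add up, as the steps are contractions that commute with `U`
  have hind (k : ℕ) : ‖U (k * (κ m)⁻¹) ψ - (J m ^ k) ψ‖ ≤ k * (δ * |(κ m)⁻¹|) := by
    induction k with
    | zero => simp [hU.map_zero]
    | succ k ih =>
      have e : U ((k + 1 : ℕ) * (κ m)⁻¹) ψ - (J m ^ (k + 1)) ψ =
          U (κ m)⁻¹ (U (k * (κ m)⁻¹) ψ - (J m ^ k) ψ) +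
            (J m ^ k) (U (κ m)⁻¹ ψ - J m ψ) := by
        have : ((k + 1 : ℕ) : ℝ) * (κ m)⁻¹ = (κ m)⁻¹ + k * (κ m)⁻¹ := by push_cast; ring
        rw [this, hU.map_add, pow_succ, map_sub, map_sub, hcomm, ContinuousLinearMap.comp_apply,
          mul_apply_eq_comp]
        abel
      rw [e]
      refine (norm_add_le _ _).trans ?_
      rw [hU.norm_map]
      have h3 := (J m ^ k).le_of_opNorm_le (hJk m k) (U (κ m)⁻¹ ψ - J m ψ)
      rw [Nat.cast_succ]
      linarith
  have hfin := hind (m + 1)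
  have e : ((m + 1 : ℕ) : ℝ) * (κ m)⁻¹ = t := by
    have : ((m + 1 : ℕ) : ℝ) ≠ 0 := by exact_mod_cast m.succ_ne_zero
    rw [hκ]
    field_simp
  have e' : ((m + 1 : ℕ) : ℝ) * |(κ m)⁻¹| = |t| := by
    rw [← e, abs_mul, Nat.abs_cast]
  rw [e, mul_left_comm, e'] at hfin
  rw [dist_comm, dist_eq_norm]
  refine hfin.trans_lt ?_
  have : δ * (|t| + 1) = ε / 2 := by rw [hδ]; field_simp
  nlinarith [abs_nonneg t]

end IsUnitaryGroupOf

end SelfAdjoint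

/-! ### Stone's theorem: a self-adjoint operator generates a unitary group -/

section Stone

variable {E : Type*} [NormedAddCommGroup E] [InnerProductSpace ℂ E] [CompleteSpace E]

theorem norm_exp_smul_apply {A : E →L[ℂ] E} (hA : IsSelfAdjoint A) (t : ℝ) (ψ : E) :
    ‖NormedSpace.exp (t • ((-Complex.I) • A)) ψ‖ = ‖ψ‖ := by
  have hs : IsSelfAdjoint ((-t) • A) := (IsSelfAdjoint.all (-t)).smul hA
  have e : NormedSpace.exp (t • ((-Complex.I) • A)) =
      (selfAdjoint.expUnitary (⟨(-t) • A, hs⟩ : selfAdjoint (E →L[ℂ] E)) : E →L[ℂ] E) := by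
    rw [selfAdjoint.expUnitary_coe]
    congr 1
    change _ = Complex.I • ((-t) • A)
    module
  rw [e]
  exact ContinuousLinearMap.norm_map_of_mem_unitary (Subtype.prop _) ψ

theorem hasDerivAt_exp_smul_apply (B : E →L[ℂ] E) (t : ℝ) (ψ : E) :
    HasDerivAt (fun s : ℝ => NormedSpace.exp (s • B) ψ) (NormedSpace.exp (t • B) (B ψ)) t := by
  have h := hasDerivAt_exp_smul_const (𝕂 := ℝ) B t
  exact ((ContinuousLinearMap.apply ℂ E ψ).restrictScalars ℝ).hasFDerivAt.comp_hasDerivAt t h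

theorem norm_exp_smul_apply_sub_le {A : E →L[ℂ] E} (hA : IsSelfAdjoint A) (t : ℝ) (ψ : E) :
    ‖NormedSpace.exp (t • ((-Complex.I) • A)) ψ - ψ‖ ≤ |t| * ‖A ψ‖ := by
  have h := (convex_uIcc (0 : ℝ) t).norm_image_sub_le_of_norm_hasDerivWithin_le
    (fun s _ => (hasDerivAt_exp_smul_apply ((-Complex.I) • A) s ψ).hasDerivWithinAt)
    (C := ‖A ψ‖) (fun s _ => by
      rw [norm_exp_smul_apply hA, smul_apply, norm_smul]
      simp) Set.left_mem_uIcc Set.right_mem_uIcc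
  rw [zero_smul, NormedSpace.exp_zero, sub_zero, Real.norm_eq_abs, mul_comm] at h
  exact h

/-- The unitary groups of two commuting bounded operators are as close as the operators. -/
theorem norm_exp_smul_sub_exp_smul_le {A B : E →L[ℂ] E} (hA : IsSelfAdjoint A)
    (hB : IsSelfAdjoint B) (hAB : Commute A B) (t : ℝ) (ψ : E) :
    ‖NormedSpace.exp (t • ((-Complex.I) • A)) ψ - NormedSpace.exp (t • ((-Complex.I) • B)) ψ‖ ≤
      |t| * ‖A ψ - B ψ‖ := by
  have hc : Commute (t • ((-Complex.I) • B)) (t • ((-Complex.I) • (A - B))) := by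
    refine Commute.smul_left (Commute.smul_right (Commute.smul_left (Commute.smul_right ?_ _) _) _)
      _
    exact hAB.symm.sub_right (Commute.refl B)
  have e : NormedSpace.exp (t • ((-Complex.I) • A)) =
      NormedSpace.exp (t • ((-Complex.I) • B)) *
        NormedSpace.exp (t • ((-Complex.I) • (A - B))) := by
    let : NormedAlgebra ℚ (E →L[ℂ] E) := .restrictScalars ℚ ℂ _
    rw [← NormedSpace.exp_add_of_commute hc]
    congr 1
    module
  rw [e, mul_apply_eq_comp, ← map_sub, norm_exp_smul_apply hB, ← sub_apply]
  exact norm_exp_smul_apply_sub_le (hA.sub hB) t ψ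

/-- A bound of the error in `e^{-itA} ψ ≈ ψ - itAψ` by means of a second vector `χ`. With `χ` close
to `A ψ` it stays useful along a sequence of operators `A` with unbounded norms. -/
theorem norm_exp_smul_apply_sub_add_le {A : E →L[ℂ] E} (hA : IsSelfAdjoint A) (t : ℝ) (ψ χ : E) :
    ‖NormedSpace.exp (t • ((-Complex.I) • A)) ψ - ψ + t • (Complex.I • A ψ)‖ ≤
      (2 * ‖A ψ - χ‖ + |t| * ‖A χ‖) * |t| := by
  set V : ℝ → E →L[ℂ] E := fun s => NormedSpace.exp (s • ((-Complex.I) • A)) with hV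
  let g : ℝ → E := fun s => V s ψ + s • (Complex.I • A ψ)
  have hg : ∀ s, HasDerivAt g (V s (((-Complex.I) • A) ψ) + Complex.I • A ψ) s := fun s => by
    have := (hasDerivAt_exp_smul_apply ((-Complex.I) • A) s ψ).fun_add
      ((hasDerivAt_id s).smul_const (Complex.I • A ψ))
    simpa only [one_smul, id] using this
  have h := (convex_uIcc (0 : ℝ) t).norm_image_sub_le_of_norm_hasDerivWithin_le
    (fun s _ => (hg s).hasDerivWithinAt) (C := 2 * ‖A ψ - χ‖ + |t| * ‖A χ‖) (fun s hs => by
      have hs' : |s| ≤ |t| := by simpa using Set.abs_sub_left_of_mem_uIcc hs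
      have e : V s (((-Complex.I) • A) ψ) + Complex.I • A ψ =
          (-Complex.I) • (V s (A ψ - χ) - (A ψ - χ) + (V s χ - χ)) := by
        rw [smul_apply, map_smul, map_sub]
        module
      rw [e, norm_smul, norm_neg, Complex.norm_I, one_mul]
      have h1 : ‖V s (A ψ - χ)‖ = ‖A ψ - χ‖ := norm_exp_smul_apply hA s _
      have h2 : ‖V s χ - χ‖ ≤ |s| * ‖A χ‖ := norm_exp_smul_apply_sub_le hA s χ
      have h3 := mul_le_mul_of_nonneg_right hs' (norm_nonneg (A χ))
      have h4 := norm_add_le (V s (A ψ - χ) - (A ψ - χ)) (V s χ - χ)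
      have h5 := norm_sub_le (V s (A ψ - χ)) (A ψ - χ)
      linarith) Set.left_mem_uIcc Set.right_mem_uIcc
  have h0 : g 0 = ψ := by simp [g, hV]
  rw [h0, sub_zero, Real.norm_eq_abs] at h
  convert h using 2
  simp only [g]
  abel

/-- The Yosida-type approximants `κ²/2 ((H - iκ)⁻¹ + (H + iκ)⁻¹) = H (1 + H²/κ²)⁻¹`, `κ → ∞`:
commuting bounded self-adjoint operators that converge to `H` on its domain. -/
theorem exists_bounded_approximants {H : E →ₗ.[ℂ] E} (hH : IsSelfAdjoint H) :
    ∃ A : ℕ → E →L[ℂ] E, (∀ n, IsSelfAdjoint (A n)) ∧ (∀ m n, Commute (A m) (A n)) ∧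
      ∀ ψ : H.domain, Tendsto (fun n => A n ψ) atTop (𝓝 (H ψ)) := by
  set κ : ℕ → ℝ := fun n => n + 1 with hκ
  have hκ0 (n : ℕ) : κ n ≠ 0 := by positivity
  have hκ0' (n : ℕ) : -κ n ≠ 0 := neg_ne_zero.2 (hκ0 n)
  have hlim : Tendsto (fun n => |κ n|⁻¹) atTop (𝓝 0) := by
    refine tendsto_one_div_add_atTop_nhds_zero_nat.congr fun n => ?_
    rw [abs_of_pos (by positivity), one_div]
  have hlim' : Tendsto (fun n => |-κ n|⁻¹) atTop (𝓝 0) := by simpa only [abs_neg] using hlim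
  have hex (n : ℕ) := exists_isResolventAt hH (w := κ n * Complex.I) (by simpa using hκ0 n)
  have hex' (n : ℕ) := exists_isResolventAt hH (w := (-κ n : ℝ) * Complex.I)
    (by simpa using hκ0 n)
  choose R hR using hex
  choose R' hR' using hex'
  refine ⟨fun n => ((κ n) ^ 2 / 2) • (R n + R' n), fun n => ?_, fun m n => ?_, fun ψ => ?_⟩
  · rw [ContinuousLinearMap.isSelfAdjoint_iff']
    have hc : (starRingEnd ℂ) (κ n * Complex.I) = (-κ n : ℝ) * Complex.I := by simp
    have hc' : (starRingEnd ℂ) ((-κ n : ℝ) * Complex.I) = κ n * Complex.I := by simp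
    symm
    rw [ContinuousLinearMap.eq_adjoint_iff]
    intro φ χ
    have h1 := (hR n).inner_left hH (R' := R' n) (hc ▸ hR' n) φ χ
    have h2 := (hR' n).inner_left hH (R' := R n) (hc' ▸ hR n) φ χ
    simp only [smul_apply, add_apply, ← Complex.coe_smul, inner_smul_left, inner_smul_right,
      inner_add_left, inner_add_right, h1, h2, Complex.conj_ofReal]
    ring
  · refine Commute.smul_left (Commute.smul_right ?_ _) _
    exact (((hR m).commute (hR n)).add_right ((hR m).commute (hR' n))).add_left
      (((hR' m).commute (hR n)).add_right ((hR' m).commute (hR' n)))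
  · have h1 := tendsto_smul_resolvent hH hκ0 hlim hR (H ψ)
    have h2 := tendsto_smul_resolvent hH hκ0' hlim' hR' (H ψ)
    have h3 := (h1.add h2).const_smul ((1 : ℂ) / 2)
    have e : ((1 : ℂ) / 2) • (H ψ + H ψ) = H ψ := by module
    rw [e] at h3
    refine h3.congr fun n => ?_
    have e1 := (hR n).1 ψ
    have e2 := (hR' n).1 ψ
    rw [map_sub, map_smul, sub_eq_iff_eq_add] at e1 e2
    simp only [smul_apply, add_apply, e1, e2, ← Complex.coe_smul]
    push_cast
    match_scalars
    · ring
    · linear_combination (-(κ n : ℂ) ^ 2 / 2) * Complex.I_sq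
    · linear_combination (-(κ n : ℂ) ^ 2 / 2) * Complex.I_sq

/-- **Stone's theorem**, existence part: the unitary groups of the bounded approximants converge
strongly, uniformly for bounded times on the domain of `H`, and the limit has generator `-iH`. -/
theorem exists_isUnitaryGroupOf {H : E →ₗ.[ℂ] E} (hH : IsSelfAdjoint H) :
    ∃ U : ℝ → E →L[ℂ] E, IsUnitaryGroupOf H U := by
  obtain ⟨A, hA, hAc, hAt⟩ := exists_bounded_approximants hH
  set V : ℕ → ℝ → E →L[ℂ] E := fun n t => NormedSpace.exp (t • ((-Complex.I) • A n)) with hV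
  have hVn (n : ℕ) (t : ℝ) (ψ : E) : ‖V n t ψ‖ = ‖ψ‖ := norm_exp_smul_apply (hA n) t ψ
  have hVd (n m : ℕ) (t : ℝ) (ψ : E) : ‖V n t ψ - V m t ψ‖ ≤ |t| * ‖A n ψ - A m ψ‖ :=
    norm_exp_smul_sub_exp_smul_le (hA n) (hA m) (hAc n m) t ψ
  have hcau (t : ℝ) (ψ : E) : CauchySeq fun n => V n t ψ := by
    rw [Metric.cauchySeq_iff']
    intro ε hε
    obtain ⟨χ, hχ, hd⟩ := hH.dense_domain.exists_dist_lt ψ (ε := ε / 3) (by positivity)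
    rw [dist_eq_norm] at hd
    obtain ⟨N, hN⟩ := Metric.cauchySeq_iff'.1 (hAt ⟨χ, hχ⟩).cauchySeq (ε / 3 / (|t| + 1))
      (by positivity)
    refine ⟨N, fun n hn => ?_⟩
    have h1 := hN n hn
    dsimp only at h1
    rw [dist_eq_norm, lt_div_iff₀ (by positivity)] at h1
    have h2 := hVd n N t χ
    have e : V n t ψ - V N t ψ = V n t (ψ - χ) - V N t (ψ - χ) + (V n t χ - V N t χ) := by
      rw [map_sub, map_sub]; abel
    rw [dist_eq_norm, e]
    have h3 := norm_add_le (V n t (ψ - χ) - V N t (ψ - χ)) (V n t χ - V N t χ)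
    have h4 := norm_sub_le (V n t (ψ - χ)) (V N t (ψ - χ))
    rw [hVn, hVn] at h4
    nlinarith [norm_nonneg (A n χ - A N χ)]
  have hlim (t : ℝ) (ψ : E) := cauchySeq_tendsto_of_complete (hcau t ψ)
  choose u hu using hlim
  let U : ℝ → E →L[ℂ] E := fun t =>
    continuousLinearMapOfTendsto (fun n => V n t) (f := u t) (tendsto_pi_nhds.2 (hu t))
  have hU (t : ℝ) (ψ : E) : Tendsto (fun n => V n t ψ) atTop (𝓝 (U t ψ)) := hu t ψ
  have hUn (t : ℝ) (ψ : E) : ‖U t ψ‖ = ‖ψ‖ :=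
    tendsto_nhds_unique (hU t ψ).norm (by simp only [hVn]; exact tendsto_const_nhds)
  have hU0 : U 0 = 1 := by
    ext ψ
    refine tendsto_nhds_unique (hU 0 ψ) ?_
    simp [hV]
  have hUa (s t : ℝ) : U (s + t) = U s ∘L U t := by
    ext ψ
    refine tendsto_nhds_unique (hU (s + t) ψ) ?_
    have h1 : Tendsto (fun n => V n s (V n t ψ - U t ψ)) atTop (𝓝 0) := by
      refine squeeze_zero_norm (fun n => (hVn n s _).le) ?_
      exact tendsto_iff_norm_sub_tendsto_zero.1 (hU t ψ)
    have h2 := h1.add (hU s (U t ψ))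
    rw [zero_add] at h2
    refine h2.congr fun n => ?_
    have e : V n (s + t) = V n s * V n t := by
      let : NormedAlgebra ℚ (E →L[ℂ] E) := .restrictScalars ℚ ℂ _
      simp only [hV]
      rw [add_smul, NormedSpace.exp_add_of_commute]
      exact Commute.smul_left (Commute.smul_right (Commute.refl _) _) _
    rw [e, mul_apply_eq_comp, map_sub, sub_add_cancel]
  have hLip (t : ℝ) (ψ : H.domain) : ‖U t (ψ : E) - ψ‖ ≤ |t| * ‖H ψ‖ :=
    le_of_tendsto_of_tendsto' ((hU t ψ).sub_const _).norm ((hAt ψ).norm.const_mul _) fun n =>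
      norm_exp_smul_apply_sub_le (hA n) t ψ
  have hLip' (s t : ℝ) (ψ : H.domain) : ‖U t (ψ : E) - U s (ψ : E)‖ ≤ |t - s| * ‖H ψ‖ := by
    have e : U t (ψ : E) - U s (ψ : E) = U s (U (t - s) (ψ : E) - ψ) := by
      rw [map_sub, ← ContinuousLinearMap.comp_apply, ← hUa, add_sub_cancel]
    rw [e, hUn]
    exact hLip _ _
  have hUc (ψ : E) : Continuous fun t => U t ψ := by
    rw [Metric.continuous_iff]
    intro t ε hε
    obtain ⟨χ, hχ, hd⟩ := hH.dense_domain.exists_dist_lt ψ (ε := ε / 3) (by positivity)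
    rw [dist_eq_norm] at hd
    refine ⟨ε / 3 / (‖H ⟨χ, hχ⟩‖ + 1), by positivity, fun s hs => ?_⟩
    rw [Real.dist_eq, lt_div_iff₀ (by positivity)] at hs
    have e : U s ψ - U t ψ = U s (ψ - χ) - U t (ψ - χ) + (U s χ - U t χ) := by
      rw [map_sub, map_sub]; abel
    have h2 := hLip' t s ⟨χ, hχ⟩
    have h3 := norm_add_le (U s (ψ - χ) - U t (ψ - χ)) (U s χ - U t χ)
    have h4 := norm_sub_le (U s (ψ - χ)) (U t (ψ - χ))
    rw [hUn, hUn] at h4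
    rw [dist_eq_norm, e]
    dsimp only at h2
    nlinarith [abs_nonneg (s - t)]
  have hder (ψ : H.domain) : HasDerivAt (fun t : ℝ => U t (ψ : E)) (-(Complex.I • H ψ)) 0 := by
    have hb (t : ℝ) (χ : H.domain) : ‖U t (ψ : E) - ψ + t • (Complex.I • H ψ)‖ ≤
        (2 * ‖H ψ - χ‖ + |t| * ‖H χ‖) * |t| :=
      le_of_tendsto_of_tendsto'
        (((hU t ψ).sub_const _).add (((hAt ψ).const_smul Complex.I).const_smul t)).norm
        (((((hAt ψ).sub_const _).norm.const_mul 2).add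
          ((hAt χ).norm.const_mul _)).mul_const _) fun n =>
        norm_exp_smul_apply_sub_add_le (hA n) t ψ χ
    rw [hasDerivAt_iff_isLittleO_nhds_zero, Asymptotics.isLittleO_iff]
    intro ε hε
    obtain ⟨χ, hχ, hd⟩ := hH.dense_domain.exists_dist_lt (H ψ) (ε := ε / 4) (by positivity)
    rw [dist_eq_norm] at hd
    filter_upwards [Metric.ball_mem_nhds (0 : ℝ) (ε := ε / 2 / (‖H ⟨χ, hχ⟩‖ + 1))
      (by positivity)] with t ht
    rw [mem_ball_zero_iff, lt_div_iff₀ (by positivity), Real.norm_eq_abs] at ht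
    have h1 := hb t ⟨χ, hχ⟩
    rw [zero_add, hU0, one_apply_eq_self, smul_neg, sub_neg_eq_add, Real.norm_eq_abs]
    refine h1.trans (mul_le_mul_of_nonneg_right ?_ (abs_nonneg t))
    dsimp only
    nlinarith [abs_nonneg t]
  have hinner (t : ℝ) (ψ χ : E) : inner ℂ (U t ψ) χ = inner ℂ ψ (U (-t) χ) := by
    have e : χ = U t (U (-t) χ) := by
      rw [← ContinuousLinearMap.comp_apply, ← hUa, add_neg_cancel, hU0, one_apply_eq_self]
    conv_lhs => rw [e]
    exact (LinearIsometry.mk (U t).toLinearMap (hUn t)).inner_map_map ψ _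
  refine ⟨U, hU0, hUa, hUn, hUc, fun ψ φ => ⟨fun h => ?_, fun h => ?_⟩⟩
  · obtain ⟨χ, h1, h2⟩ := H.mem_graph_iff.1 h
    dsimp only at h1 h2
    subst h1 h2
    exact hder χ
  · refine mem_graph_of_forall_inner hH fun χ => ?_
    have h1 : HasDerivAt (fun t : ℝ => inner ℂ (U t ψ) (χ : E))
        (inner ℂ (-(Complex.I • φ)) (χ : E)) 0 := by
      have := h.inner ℂ (hasDerivAt_const (0 : ℝ) (χ : E))
      simpa only [inner_zero_right, zero_add] using this
    have h2 : HasDerivAt (fun t : ℝ => U (-t) (χ : E)) (Complex.I • H χ) 0 := by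
      have h3 := HasDerivAt.scomp_of_eq (0 : ℝ) (hder χ) (hasDerivAt_neg (0 : ℝ)) (by simp)
      rw [neg_smul, one_smul, neg_neg] at h3
      exact h3
    have h4 : HasDerivAt (fun t : ℝ => inner ℂ (U t ψ) (χ : E))
        (inner ℂ ψ (Complex.I • H χ)) 0 := by
      simp only [hinner]
      have := (hasDerivAt_const (0 : ℝ) ψ).inner ℂ h2
      simpa only [inner_zero_left, add_zero] using this
    have h5 := h1.unique h4
    rw [inner_neg_left, inner_smul_left, inner_smul_right, Complex.conj_I, neg_mul, neg_neg] at h5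
    exact mul_left_cancel₀ Complex.I_ne_zero h5

theorem isUnitaryGroupOf_propagator {H : E →ₗ.[ℂ] E} (hH : IsSelfAdjoint H) :
    IsUnitaryGroupOf H (propagator H) := by
  have h := exists_isUnitaryGroupOf hH
  rw [propagator, dif_pos h]
  exact h.choose_spec

end Stone

/-! ### Calculus of multiplication operators -/

section Multiplication

variable {n : ℕ}

theorem mulOp_eq_mul {φ χ ω : Space n → ℂ} (hφ : MemLp φ ∞ (volume : Measure (Space n)))
    (hχ : MemLp χ ∞ (volume : Measure (Space n))) (hω : MemLp ω ∞ (volume : Measure (Space n)))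
    (h : ∀ x, ω x = φ x * χ x) : mulOp ω hω = mulOp φ hφ * mulOp χ hχ := by
  ext1 ψ
  apply Lp.ext
  filter_upwards [mulOp_apply_ae φ hφ (mulOp χ hχ ψ), mulOp_apply_ae χ hχ ψ,
    mulOp_apply_ae ω hω ψ] with x h1 h2 h3
  rw [h3, mul_apply_eq_comp, h1, h2, h, mul_assoc]

theorem norm_mulOp_le {φ : Space n → ℂ} (hφ : MemLp φ ∞ (volume : Measure (Space n))) {C : ℝ}
    (hC : 0 ≤ C) (h : ∀ x, ‖φ x‖ ≤ C) : ‖mulOp φ hφ‖ ≤ C := by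
  refine ContinuousLinearMap.opNorm_le_bound _ hC fun ψ => ?_
  refine Lp.norm_le_mul_norm_of_ae_le_mul ?_
  filter_upwards [mulOp_apply_ae φ hφ ψ] with x hx
  rw [hx, norm_mul]
  exact mul_le_mul_of_nonneg_right (h x) (norm_nonneg _)

theorem mulOp_eq_sub {φ χ ω : Space n → ℂ} (hφ : MemLp φ ∞ (volume : Measure (Space n)))
    (hχ : MemLp χ ∞ (volume : Measure (Space n))) (hω : MemLp ω ∞ (volume : Measure (Space n)))
    (h : ∀ x, ω x = φ x - χ x) : mulOp ω hω = mulOp φ hφ - mulOp χ hχ := by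
  ext1 ψ
  apply Lp.ext
  filter_upwards [mulOp_apply_ae φ hφ ψ, mulOp_apply_ae χ hχ ψ, mulOp_apply_ae ω hω ψ,
    Lp.coeFn_sub (mulOp φ hφ ψ) (mulOp χ hχ ψ)] with x h1 h2 h3 h4
  rw [h3, sub_apply, h4, Pi.sub_apply, h1, h2, h, sub_mul]

theorem mulOp_eq_smul {φ ω : Space n → ℂ} (hφ : MemLp φ ∞ (volume : Measure (Space n)))
    (hω : MemLp ω ∞ (volume : Measure (Space n))) {c : ℂ}
    (h : ∀ x, ω x = c * φ x) : mulOp ω hω = c • mulOp φ hφ := by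
  ext1 ψ
  apply Lp.ext
  filter_upwards [mulOp_apply_ae φ hφ ψ, mulOp_apply_ae ω hω ψ,
    Lp.coeFn_smul c (mulOp φ hφ ψ)] with x h1 h2 h3
  rw [h2, smul_apply, h3, Pi.smul_apply, h1, h, smul_eq_mul, mul_assoc]

theorem T_mul_T_neg (ξ : Space n) : T ξ * T (-ξ) = 1 := T_comp_T_neg ξ

theorem T_neg_mul_T (ξ : Space n) : T (-ξ) * T ξ = 1 := by
  simpa using T_mul_T_neg (-ξ)

theorem norm_chi_le {X : Set (Space n)} (hX : MeasurableSet X) : ‖chi X hX‖ ≤ 1 :=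
  norm_mulOp_le _ zero_le_one fun x => by by_cases hx : x ∈ X <;> simp [hx]

theorem chi_mul_chi {X Y Z : Set (Space n)} (hX : MeasurableSet X) (hY : MeasurableSet Y)
    (hZ : MeasurableSet Z) (h : X ∩ Y = Z) : chi X hX * chi Y hY = chi Z hZ :=
  (mulOp_eq_mul _ _ _ fun x => by
    subst h
    by_cases hx : x ∈ X <;> by_cases hy : x ∈ Y <;> simp [hx, hy]).symm

theorem chi_empty : chi (∅ : Set (Space n)) MeasurableSet.empty = 0 := by
  have : chi (∅ : Set (Space n)) MeasurableSet.empty = (0 : ℂ) • chi ∅ MeasurableSet.empty :=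
    mulOp_eq_smul _ _ fun x => by simp
  rw [this, zero_smul]

theorem chi_compl {X : Set (Space n)} (hX : MeasurableSet X) : chi Xᶜ hX.compl = 1 - chi X hX := by
  have h1 : chi (Set.univ : Set (Space n)) MeasurableSet.univ = 1 := by
    ext1 ψ
    apply Lp.ext
    filter_upwards [mulOp_apply_ae _ (memLp_indicator MeasurableSet.univ) ψ] with x h1
    rw [one_apply_eq_self]
    exact h1.trans (by simp)
  rw [← h1]
  exact mulOp_eq_sub _ _ _ fun x => by by_cases hx : x ∈ X <;> simp [hx]

/-! ### Exponential weights on bounded sets -/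

/-- The function `x ↦ e^{s v·x}` on the set `Q`, extended by zero. -/
def expWeight (Q : Set (Space n)) (v : Space n) (s : ℂ) : Space n → ℂ :=
  Q.indicator fun x => Complex.exp (s * ((inner ℝ v x : ℝ) : ℂ))

theorem exists_abs_inner_le {Q : Set (Space n)} (hQ : Bornology.IsBounded Q) (v : Space n) :
    ∃ r : ℝ, 0 ≤ r ∧ ∀ x ∈ Q, |(inner ℝ v x : ℝ)| ≤ r := by
  obtain ⟨r, hr⟩ := hQ.exists_norm_le
  refine ⟨‖v‖ * max r 0, by positivity, fun x hx => ?_⟩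
  exact (abs_real_inner_le_norm v x).trans
    (mul_le_mul_of_nonneg_left ((hr x hx).trans (le_max_left _ _)) (norm_nonneg _))

theorem norm_expWeight_le {Q : Set (Space n)} {v : Space n} {s : ℂ} {c : ℝ}
    (h : ∀ x ∈ Q, s.re * inner ℝ v x ≤ c) (x : Space n) : ‖expWeight Q v s x‖ ≤ Real.exp c := by
  by_cases hx : x ∈ Q
  · rw [expWeight, Set.indicator_of_mem hx, Complex.norm_exp, Complex.re_mul_ofReal]
    exact Real.exp_le_exp.2 (h x hx)
  · rw [expWeight, Set.indicator_of_notMem hx, norm_zero]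
    exact (Real.exp_pos c).le

theorem memLp_expWeight {Q : Set (Space n)} (hQ : MeasurableSet Q) (hQb : Bornology.IsBounded Q)
    (v : Space n) (s : ℂ) : MemLp (expWeight Q v s) ∞ (volume : Measure (Space n)) := by
  obtain ⟨r, -, h⟩ := exists_abs_inner_le hQb v
  refine memLp_top_of_bound ?_ (Real.exp (|s.re| * r)) (Eventually.of_forall
    (norm_expWeight_le fun x hx => ?_))
  · refine (Measurable.indicator ?_ hQ).aestronglyMeasurable
    exact Continuous.measurable (by fun_prop)
  · refine (le_abs_self _).trans ?_
    rw [abs_mul]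
    exact mul_le_mul_of_nonneg_left (h x hx) (abs_nonneg _)

/-- Multiplication by `e^{s v·x}` on the bounded set `Q` and by zero elsewhere. The cut-off makes
this a bounded operator for every complex `s`. -/
def expOp (Q : Set (Space n)) (hQ : MeasurableSet Q) (hQb : Bornology.IsBounded Q) (v : Space n)
    (s : ℂ) : L2 n →L[ℂ] L2 n :=
  mulOp (expWeight Q v s) (memLp_expWeight hQ hQb v s)

variable {Q : Set (Space n)} (hQ : MeasurableSet Q) (hQb : Bornology.IsBounded Q) (v : Space n)

theorem norm_expOp_le {s : ℂ} {c : ℝ} (h : ∀ x ∈ Q, s.re * inner ℝ v x ≤ c) :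
    ‖expOp Q hQ hQb v s‖ ≤ Real.exp c :=
  norm_mulOp_le _ (Real.exp_pos c).le (norm_expWeight_le h)

theorem expOp_mul_expOp (s s' : ℂ) :
    expOp Q hQ hQb v s * expOp Q hQ hQb v s' = expOp Q hQ hQb v (s + s') :=
  (mulOp_eq_mul _ _ _ fun x => by
    by_cases hx : x ∈ Q <;> simp [expWeight, hx, add_mul, Complex.exp_add]).symm

theorem expOp_zero : expOp Q hQ hQb v 0 = chi Q hQ := by
  have : expOp Q hQ hQb v 0 = (1 : ℂ) • chi Q hQ :=
    mulOp_eq_smul _ _ fun x => by by_cases hx : x ∈ Q <;> simp [expWeight, hx]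
  rw [this, one_smul]

theorem chi_mul_T (σ : ℝ) :
    chi Q hQ * T (σ • v) = expOp Q hQ hQb v (-Complex.I * σ) :=
  (mulOp_eq_mul _ _ _ fun x => by
    by_cases hx : x ∈ Q <;> simp [expWeight, hx, planeWave, inner_smul_left, mul_assoc]).symm

theorem T_mul_chi (σ : ℝ) :
    T (-(σ • v)) * chi Q hQ = expOp Q hQ hQb v (Complex.I * σ) :=
  (mulOp_eq_mul _ _ _ fun x => by
    by_cases hx : x ∈ Q <;>
      simp [expWeight, hx, planeWave, inner_smul_left, inner_neg_left, mul_assoc]).symm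

/-- The derivative of `s ↦ expOp Q hQ hQb v s` at `0` is multiplication by `v·x` on `Q`, with a
quadratic bound of the remainder. -/
theorem exists_norm_expOp_sub_le : ∃ (G : L2 n →L[ℂ] L2 n) (r : ℝ), 0 ≤ r ∧
    ∀ u : ℂ, ‖u‖ * r ≤ 1 → ‖expOp Q hQ hQb v u - chi Q hQ - u • G‖ ≤ (‖u‖ * r) ^ 2 := by
  obtain ⟨r, hr, h⟩ := exists_abs_inner_le hQb v
  have hg : MemLp (Q.indicator fun x => ((inner ℝ v x : ℝ) : ℂ)) ∞
      (volume : Measure (Space n)) := by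
    refine memLp_top_of_bound ?_ r (Eventually.of_forall fun x => ?_)
    · exact ((Continuous.measurable (by fun_prop)).indicator hQ).aestronglyMeasurable
    · by_cases hx : x ∈ Q
      · simpa [hx] using h x hx
      · simpa [hx] using hr
  refine ⟨mulOp _ hg, r, hr, fun u hur => ?_⟩
  have h1 : MemLp (fun x => expWeight Q v u x - Q.indicator (fun _ => (1 : ℂ)) x) ∞
      (volume : Measure (Space n)) := (memLp_expWeight hQ hQb v u).sub (memLp_indicator hQ)
  have h2 : MemLp (fun x => u * Q.indicator (fun x => ((inner ℝ v x : ℝ) : ℂ)) x) ∞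
      (volume : Measure (Space n)) := hg.const_mul u
  have e1 : expOp Q hQ hQb v u - chi Q hQ = mulOp _ h1 :=
    (mulOp_eq_sub _ _ _ fun x => rfl).symm
  have e2 : u • mulOp _ hg = mulOp _ h2 := (mulOp_eq_smul _ _ fun x => rfl).symm
  have e3 := mulOp_eq_sub h1 h2 (h1.sub h2) fun x => rfl
  rw [e1, e2, ← e3]
  refine norm_mulOp_le _ (sq_nonneg _) fun x => ?_
  by_cases hx : x ∈ Q
  · have h3 : ‖u * ((inner ℝ v x : ℝ) : ℂ)‖ ≤ ‖u‖ * r := by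
      rw [norm_mul, Complex.norm_real]
      exact mul_le_mul_of_nonneg_left (h x hx) (norm_nonneg u)
    have h4 := Complex.norm_exp_sub_one_sub_id_le (h3.trans hur)
    refine le_trans ?_ (h4.trans (pow_le_pow_left₀ (norm_nonneg _) h3 2))
    simp [expWeight, hx]
  · simp only [Pi.sub_apply, expWeight, Set.indicator_of_notMem hx, sub_zero, mul_zero, norm_zero]
    exact sq_nonneg _

/-- A one-parameter family with `W (s + u) = W s W u` that is differentiable at `0` is
differentiable everywhere. -/
theorem differentiable_of_mul_add {A : Type*} [NormedRing A] [NormedAlgebra ℂ A] {W : ℂ → A}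
    (hW : ∀ s s', W s * W s' = W (s + s')) {G : A} {r : ℝ} (hr : 0 ≤ r)
    (h : ∀ u : ℂ, ‖u‖ * r ≤ 1 → ‖W u - W 0 - u • G‖ ≤ (‖u‖ * r) ^ 2) : Differentiable ℂ W := by
  intro s
  have hd : HasDerivAt W (W s * G) s := by
    rw [hasDerivAt_iff_isLittleO_nhds_zero]
    have hO : (fun u : ℂ => W (s + u) - W s - u • (W s * G)) =O[𝓝 0] fun u : ℂ => u ^ 2 := by
      refine Asymptotics.IsBigO.of_bound (‖W s‖ * r ^ 2) ?_
      filter_upwards [Metric.ball_mem_nhds (0 : ℂ) (ε := (r + 1)⁻¹) (by positivity)] with u hu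
      rw [mem_ball_zero_iff, ← one_div, lt_div_iff₀ (by positivity)] at hu
      have hur : ‖u‖ * r ≤ 1 := by nlinarith [norm_nonneg u]
      have e : W (s + u) - W s - u • (W s * G) = W s * (W u - W 0 - u • G) := by
        rw [mul_sub, mul_sub, hW, hW, add_zero, mul_smul_comm]
      rw [e, norm_pow]
      refine (norm_mul_le _ _).trans ?_
      rw [mul_assoc, mul_comm (r ^ 2), ← mul_pow]
      exact mul_le_mul_of_nonneg_left (h u hur) (norm_nonneg _)
    exact hO.trans_isLittleO (Asymptotics.isLittleO_pow_id one_lt_two)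
  exact hd.differentiableAt

theorem differentiable_expOp : Differentiable ℂ (expOp Q hQ hQb v) := by
  obtain ⟨G, r, hr, h⟩ := exists_norm_expOp_sub_le hQ hQb v
  refine differentiable_of_mul_add (expOp_mul_expOp hQ hQb v) (G := G) hr fun u hu => ?_
  rw [expOp_zero]
  exact h u hu

end Multiplication

/-! ### Complex translations of the resolvent -/

section Translation

theorem HasBoundedImaginaryPart.abs_im_inner_le {E : Type*} [NormedAddCommGroup E]
    [InnerProductSpace ℂ E] [CompleteSpace E] {K : E →ₗ.[ℂ] E} {M : E →L[ℂ] E}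
    (h : HasBoundedImaginaryPart K M) {b : ℝ} (hM : ‖M‖ ≤ b) (ψ : K.domain) :
    |(inner ℂ (ψ : E) (K ψ)).im| ≤ b * ‖(ψ : E)‖ ^ 2 := by
  obtain ⟨hm, e⟩ := h.2 ψ
  have h1 : inner ℂ (K.adjoint ⟨ψ, hm⟩) (ψ : E) = inner ℂ (ψ : E) (K ψ) :=
    K.adjoint_isFormalAdjoint h.1 ⟨ψ, hm⟩ ψ
  have h2 := congrArg (inner ℂ (ψ : E)) e
  rw [inner_sub_right, ← inner_conj_symm (ψ : E) (K.adjoint ⟨ψ, hm⟩), h1, Complex.sub_conj,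
    inner_smul_right] at h2
  have h3 : ((inner ℂ (ψ : E) (K ψ)).im : ℂ) = inner ℂ (ψ : E) (M ψ) := by
    refine mul_left_cancel₀ (mul_ne_zero two_ne_zero Complex.I_ne_zero) ?_
    rw [← h2]
    push_cast
    ring
  have h4 : |(inner ℂ (ψ : E) (K ψ)).im| = ‖inner ℂ (ψ : E) (M ψ)‖ := by
    rw [← h3, Complex.norm_real, Real.norm_eq_abs]
  rw [h4]
  refine (norm_inner_le_norm _ _).trans ?_
  have h5 := M.le_of_opNorm_le hM (ψ : E)
  nlinarith [norm_nonneg (ψ : E)]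

theorem isOpen_strip (a : ℝ) : IsOpen {s : ℂ | |s.im| < a} :=
  isOpen_lt (by fun_prop) continuous_const

theorem isPreconnected_strip (a : ℝ) : IsPreconnected {s : ℂ | |s.im| < a} := by
  have : {s : ℂ | |s.im| < a} = Complex.imCLM ⁻¹' Set.Ioo (-a) a := by
    ext s
    simp [abs_lt]
  rw [this]
  exact ((convex_Ioo (-a) a).linear_preimage Complex.imCLM.toLinearMap).isPreconnected

variable {n : ℕ}

/-- Under Condition (A), the translated resolvents `T_{σv} (H - w)⁻¹ T_{-σv}`, `σ ∈ ℝ`, continue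
analytically to a strip, as soon as `w` is outside of all the numerical ranges. -/
theorem ConditionA.exists_analytic_resolvent {H : L2 n →ₗ.[ℂ] L2 n} {a : ℝ} (h : ConditionA H a)
    {a' : ℝ} (ha' : 0 < a') (haa' : a' < a) :
    ∃ b : ℝ, 0 ≤ b ∧ ∀ v : Space n, ‖v‖ ≤ 1 → ∀ w : ℂ, b < |w.im| → ∀ R₀ : L2 n →L[ℂ] L2 n,
      IsResolventAt H w R₀ → ∃ R : ℂ → L2 n →L[ℂ] L2 n,
        AnalyticOnNhd ℂ R {s | |s.im| < a'} ∧
        (∀ s : ℂ, |s.im| < a' → ‖R s‖ ≤ (|w.im| - b)⁻¹) ∧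
        ∀ σ : ℝ, R σ = T (σ • v) * R₀ * T (-(σ • v)) := by
  obtain ⟨K, M, hK, hKato, hIm, hb⟩ := h
  obtain ⟨b₀, hb₀⟩ := hb a' haa'
  refine ⟨max b₀ 0, le_max_right _ _, fun v hv w hw R₀ hR₀ => ?_⟩
  set ζ : ℂ → Fin n → ℂ := fun s j => s * ((v j : ℝ) : ℂ) with hζ
  have hmem (s : ℂ) (hs : |s.im| < a') : ζ s ∈ polystrip n a' := by
    intro j
    have h1 : |v j| ≤ 1 := (PiLp.norm_apply_le v j).trans hv
    have h2 : (ζ s j).im = s.im * v j := by simp [hζ]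
    rw [h2, abs_mul]
    exact (mul_le_of_le_one_right (abs_nonneg _) h1).trans_lt hs
  have hmem' (s : ℂ) (hs : |s.im| < a') : ζ s ∈ polystrip n a := fun j => (hmem s hs j).trans haa'
  have hζa (s : ℂ) : AnalyticAt ℂ ζ s :=
    analyticAt_pi_iff.2 fun j => analyticAt_id.fun_mul analyticAt_const
  have hreal (σ : ℝ) : K (ζ σ) = sandwich (T (σ • v)) H (T (-(σ • v))) := by
    rw [← hK]
    congr 1
    ext j
    simp [hζ]
  have hres (σ : ℝ) {R' : L2 n →L[ℂ] L2 n} (hR' : IsResolventAt H w R') :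
      IsResolventAt (K (ζ σ)) w (T (σ • v) * R' * T (-(σ • v))) := by
    rw [hreal]
    exact hR'.sandwich (T_mul_T_neg _) (T_neg_mul_T _)
  have hnum : ∀ s ∈ {s : ℂ | |s.im| < a'}, ∀ ψ : (K (ζ s)).domain,
      |(inner ℂ (ψ : L2 n) (K (ζ s) ψ)).im| ≤ max b₀ 0 * ‖(ψ : L2 n)‖ ^ 2 := fun s hs ψ =>
    (hIm _ (hmem' s hs)).abs_im_inner_le ((hb₀ _ (hmem s hs)).trans (le_max_left _ _)) ψ
  obtain ⟨R, hR, hRa⟩ := LiebRobinson.exists_analytic_resolvent (K := fun s => K (ζ s))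
    (isOpen_strip a') (isPreconnected_strip a') (fun s hs => by
      obtain ⟨z, R, h1, h2⟩ := hKato _ (hmem' s hs)
      exact ⟨z, fun s' => R (ζ s'), (hζa s).continuousAt.eventually h1,
        AnalyticAt.comp (g := R) (f := ζ) h2 (hζa s)⟩)
    hnum hw (s₀ := ((0 : ℝ) : ℂ)) (by simpa using ha') (hres 0 hR₀)
  refine ⟨R, hRa, fun s hs => (hR s hs).norm_le (hnum s hs) hw, fun σ => ?_⟩
  exact (hR σ (by simpa using ha')).unique (hres σ hR₀)

theorem smul_conj_pow {A : Type*} [Ring A] [Algebra ℂ A] {S S' : A} (h : S' * S = 1) (c : ℂ)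
    (x : A) (m : ℕ) : (c • (S * x * S')) ^ (m + 1) = S * (c • x) ^ (m + 1) * S' := by
  induction m with
  | zero => simp
  | succ m ih =>
    rw [pow_succ, ih, pow_succ (c • x) (m + 1)]
    calc S * (c • x) ^ (m + 1) * S' * (c • (S * x * S'))
        = S * (c • x) ^ (m + 1) * (S' * S) * (c • x) * S' := by
          simp only [mul_assoc, mul_smul_comm, smul_mul_assoc]
      _ = S * ((c • x) ^ (m + 1) * (c • x)) * S' := by rw [h, mul_one, mul_assoc S]

theorem analyticOnNhd_smul_pow {A : Type*} [NormedRing A] [NormedAlgebra ℂ A] {G : ℂ → A}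
    {D : Set ℂ} (hG : AnalyticOnNhd ℂ G D) (c : ℂ) (k : ℕ) :
    AnalyticOnNhd ℂ (fun s => (c • G s) ^ k) D := fun s hs =>
  (analyticAt_const.fun_smul (hG s hs)).fun_pow k

theorem norm_smul_pow_le {A : Type*} [NormedRing A] [NormedAlgebra ℂ A] {x : A} {β : ℝ}
    (hx : ‖x‖ ≤ β) (c : ℂ) (m : ℕ) : ‖(c • x) ^ (m + 1)‖ ≤ (‖c‖ * β) ^ (m + 1) := by
  refine (norm_pow_le' _ m.succ_pos).trans (pow_le_pow_left₀ (norm_nonneg _) ?_ _)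
  rw [norm_smul]
  exact mul_le_mul_of_nonneg_left hx (norm_nonneg c)

theorem norm_mul_mul_le {A : Type*} [NormedRing A] {x y z : A} {α β γ : ℝ} (hx : ‖x‖ ≤ α)
    (hy : ‖y‖ ≤ β) (hz : ‖z‖ ≤ γ) : ‖x * y * z‖ ≤ α * β * γ := by
  have h0 := (norm_nonneg x).trans hx
  have h1 := (norm_nonneg y).trans hy
  exact (norm_mul_le _ _).trans (mul_le_mul ((norm_mul_le _ _).trans
    (mul_le_mul hx hy (norm_nonneg _) h0)) hz (norm_nonneg _) (mul_nonneg h0 h1))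

/-- The identity theorem behind the complex translations: if conjugation of `J` by the one-parameter
families `W`, `W'` along the imaginary axis continues to an analytic function `F` on the strip
`|Im s| < a'`, then conjugation along the real axis is `F (iμ)`. -/
theorem mul_mul_eq_of_analyticOnNhd {A : Type*} [NormedRing A] [NormedAlgebra ℂ A] [CompleteSpace A]
    {W W' F : ℂ → A} {J : A} {a' μ : ℝ} (hW : ∀ s s', W s * W s' = W (s + s'))
    (hW' : ∀ s s', W' s * W' s' = W' (s + s')) (hWd : Differentiable ℂ W)
    (hWd' : Differentiable ℂ W') (hF : AnalyticOnNhd ℂ F {s | |s.im| < a'})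
    (hFr : ∀ σ : ℝ, W 0 * F σ * W' 0 = W (-Complex.I * σ) * J * W' (Complex.I * σ))
    (hμ : 0 < μ) (hμa : μ < a') :
    W 0 * J * W' 0 = W (-μ : ℝ) * F (μ * Complex.I) * W' (μ : ℝ) := by
  set f : ℂ → A := fun s => W 0 * F s * W' 0 with hf
  set g : ℂ → A := fun s => W (-Complex.I * s) * J * W' (Complex.I * s) with hg
  have hfa : AnalyticOnNhd ℂ f {s | |s.im| < a'} := fun s hs =>
    (analyticAt_const.fun_mul (hF s hs)).fun_mul analyticAt_const
  have hga : AnalyticOnNhd ℂ g {s | |s.im| < a'} := by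
    have h1 : Differentiable ℂ fun s : ℂ => W (-Complex.I * s) := hWd.fun_comp (by fun_prop)
    have h2 : Differentiable ℂ fun s : ℂ => W' (Complex.I * s) := hWd'.fun_comp (by fun_prop)
    exact fun s _ => ((h1.analyticAt s).fun_mul analyticAt_const).fun_mul (h2.analyticAt s)
  have hfreq : ∃ᶠ s in 𝓝[≠] (0 : ℂ), f s = g s := by
    have ht : Tendsto (fun σ : ℝ => (σ : ℂ)) (𝓝[≠] (0 : ℝ)) (𝓝[≠] (0 : ℂ)) := by
      refine tendsto_nhdsWithin_of_tendsto_nhds_of_eventually_within _ ?_ ?_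
      · exact (Complex.continuous_ofReal.tendsto' 0 0 Complex.ofReal_zero).mono_left
          nhdsWithin_le_nhds
      · filter_upwards [self_mem_nhdsWithin] with σ hσ
        exact Complex.ofReal_ne_zero.2 hσ
    exact ht.frequently (Eventually.of_forall hFr).frequently
  have heq := hfa.eqOn_of_preconnected_of_frequently_eq hga (isPreconnected_strip a')
    (z₀ := 0) (by simpa using hμ.trans hμa) hfreq
    (show (μ * Complex.I : ℂ) ∈ {s : ℂ | |s.im| < a'} by simpa [abs_of_pos hμ] using hμa)
  have e1 : -Complex.I * (μ * Complex.I) = (μ : ℝ) := by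
    linear_combination (-(μ : ℂ)) * Complex.I_mul_I
  have e2 : Complex.I * (μ * Complex.I) = (-μ : ℝ) := by
    push_cast
    linear_combination (μ : ℂ) * Complex.I_mul_I
  simp only [hf, hg, e1, e2] at heq
  have e3 : W (-μ : ℝ) * W (μ : ℝ) = W 0 := by rw [hW]; simp
  have e4 : W' (-μ : ℝ) * W' (μ : ℝ) = W' 0 := by rw [hW']; simp
  calc W 0 * J * W' 0
      = W (-μ : ℝ) * (W (μ : ℝ) * J * W' (-μ : ℝ)) * W' (μ : ℝ) := by
        rw [← e3, ← e4]
        simp only [mul_assoc]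
    _ = (W (-μ : ℝ) * W 0) * F (μ * Complex.I) * (W' 0 * W' (μ : ℝ)) := by
        rw [← heq]
        simp only [mul_assoc]
    _ = _ := by rw [hW, hW', add_zero, zero_add]

variable {P Q : Set (Space n)} (hP : MeasurableSet P) (hQ : MeasurableSet Q)

/-- If the translates `T_{σv} J T_{-σv}` continue to an analytic function `F` on the strip
`|Im s| < a'`, then `e^{μ v·x} J e^{-μ v·y}`, cut off to bounded sets, is `F (iμ)`. -/
theorem chi_mul_mul_chi_eq (hPb : Bornology.IsBounded P) (hQb : Bornology.IsBounded Q)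
    {J : L2 n →L[ℂ] L2 n} {F : ℂ → L2 n →L[ℂ] L2 n} {a' μ : ℝ}
    {v : Space n} (hF : AnalyticOnNhd ℂ F {s | |s.im| < a'})
    (hFr : ∀ σ : ℝ, F σ = T (σ • v) * J * T (-(σ • v))) (hμ : 0 < μ) (hμa : μ < a') :
    chi P hP * J * chi Q hQ =
      expOp P hP hPb v (-μ : ℝ) * F (μ * Complex.I) * expOp Q hQ hQb v (μ : ℝ) := by
  have h := mul_mul_eq_of_analyticOnNhd (J := J) (expOp_mul_expOp hP hPb v)
    (expOp_mul_expOp hQ hQb v) (differentiable_expOp hP hPb v) (differentiable_expOp hQ hQb v) hF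
    (fun σ => by
      rw [hFr, expOp_zero, expOp_zero, ← chi_mul_T hP hPb v σ, ← T_mul_chi hQ hQb v σ]
      simp only [mul_assoc]) hμ hμa
  rwa [expOp_zero, expOp_zero] at h

/-- Decay between `P` and `Q` of the powers of a multiple of `R₀`, where `G` continues the
translates of `R₀` to a strip and `c₁`, `c₂` bound the weights on `P` and `Q`. -/
theorem norm_chi_smul_pow_chi_le (hPb : Bornology.IsBounded P) (hQb : Bornology.IsBounded Q)
    {R₀ : L2 n →L[ℂ] L2 n} {G : ℂ → L2 n →L[ℂ] L2 n} {a' μ β : ℝ}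
    {v : Space n} (hG : AnalyticOnNhd ℂ G {s | |s.im| < a'})
    (hGn : ∀ s : ℂ, |s.im| < a' → ‖G s‖ ≤ β)
    (hGr : ∀ σ : ℝ, G σ = T (σ • v) * R₀ * T (-(σ • v))) (hμ : 0 < μ) (hμa : μ < a') {c₁ c₂ : ℝ}
    (hc₁ : ∀ x ∈ P, -μ * inner ℝ v x ≤ c₁) (hc₂ : ∀ y ∈ Q, μ * inner ℝ v y ≤ c₂) (c : ℂ) (m : ℕ) :
    ‖chi P hP * (c • R₀) ^ (m + 1) * chi Q hQ‖ ≤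
      Real.exp c₁ * (‖c‖ * β) ^ (m + 1) * Real.exp c₂ := by
  have h := chi_mul_mul_chi_eq (J := (c • R₀) ^ (m + 1)) hP hQ hPb hQb
    (analyticOnNhd_smul_pow hG c (m + 1))
    (fun σ => by rw [hGr, smul_conj_pow (T_neg_mul_T (σ • v))]) hμ hμa
  rw [h]
  exact norm_mul_mul_le (norm_expOp_le hP hPb v (by simpa using hc₁))
    (norm_smul_pow_le (hGn _ (by simpa [abs_of_pos hμ] using hμa)) c m)
    (norm_expOp_le hQ hQb v (by simpa using hc₂))

/-- Exponential decay of the propagator between bounded sets: `b` is a bound of the imaginary parts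
`Im H_ζ`, and `c₁`, `c₂` are bounds of the weights `e^{-μ v·x}` on `P` and `e^{μ v·y}` on `Q`. -/
theorem ConditionA.exists_norm_chi_propagator_chi_le {H : L2 n →ₗ.[ℂ] L2 n}
    (hH : IsSelfAdjoint H) {a : ℝ} (h : ConditionA H a) {μ : ℝ} (hμ : 0 < μ) (hμa : μ < a) :
    ∃ b : ℝ, 0 ≤ b ∧ ∀ v : Space n, ‖v‖ ≤ 1 → ∀ (P Q : Set (Space n)) (hP : MeasurableSet P)
      (hQ : MeasurableSet Q), Bornology.IsBounded P → Bornology.IsBounded Q → ∀ c₁ c₂ : ℝ,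
      (∀ x ∈ P, -μ * inner ℝ v x ≤ c₁) → (∀ y ∈ Q, μ * inner ℝ v y ≤ c₂) → ∀ t : ℝ, t ≠ 0 →
        ‖chi P hP * propagator H t * chi Q hQ‖ ≤ Real.exp (b * |t| + c₁ + c₂) := by
  obtain ⟨a', hμa', haa'⟩ := exists_between hμa
  obtain ⟨b, hb0, hb⟩ := h.exists_analytic_resolvent (hμ.trans hμa') haa'
  refine ⟨b, hb0, fun v hv P Q hP hQ hPb hQb c₁ c₂ hc₁ hc₂ t ht => ?_⟩
  have hU := isUnitaryGroupOf_propagator hH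
  obtain ⟨κ, hκ⟩ : ∃ κ : ℕ → ℝ, ∀ m, κ m = (m + 1 : ℕ) / t := ⟨_, fun _ => rfl⟩
  have hκabs (m : ℕ) : |κ m| = (m + 1 : ℕ) / |t| := by rw [hκ, abs_div, Nat.abs_cast]
  have htp : 0 < |t| := abs_pos.2 ht
  have hκ0 (m : ℕ) : κ m ≠ 0 := by
    rw [hκ]
    exact div_ne_zero (by exact_mod_cast m.succ_ne_zero) ht
  have hκim (m : ℕ) : |((κ m : ℂ) * Complex.I).im| = |κ m| := by simp
  have hex (m : ℕ) := exists_isResolventAt hH (w := κ m * Complex.I) (by simpa using hκ0 m)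
  choose R hR using hex
  have hlarge : ∀ᶠ m : ℕ in atTop, b < |κ m| := by
    filter_upwards [eventually_gt_atTop ⌈b * |t|⌉₊] with m hm
    rw [hκabs, lt_div_iff₀ htp]
    refine (Nat.lt_of_ceil_lt hm).trans ?_
    exact_mod_cast m.lt_succ_self
  have hbound : ∀ᶠ m : ℕ in atTop, ‖chi P hP * ((-(κ m * Complex.I)) • R m) ^ (m + 1) * chi Q hQ‖ ≤
      Real.exp c₁ * ((1 + (-(b * |t|)) / (m + 1 : ℕ)) ^ (m + 1))⁻¹ * Real.exp c₂ := by
    refine hlarge.mono fun m hm => ?_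
    have hm' : b < |((κ m : ℂ) * Complex.I).im| := by rwa [hκim]
    obtain ⟨G, hG, hGn, hGr⟩ := hb v hv _ hm' (R m) (hR m)
    refine (norm_chi_smul_pow_chi_le hP hQ hPb hQb hG hGn hGr hμ hμa' hc₁ hc₂ _ m).trans
      (le_of_eq ?_)
    have h2 : ‖(-(κ m * Complex.I) : ℂ)‖ = |κ m| := by simp
    rw [h2, hκim, ← inv_pow]
    congr 3
    have h3 : |κ m| - b ≠ 0 := (sub_pos.2 hm).ne'
    have h4 : ((m + 1 : ℕ) : ℝ) ≠ 0 := by exact_mod_cast m.succ_ne_zero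
    have h5 : 1 + (-(b * |t|)) / (m + 1 : ℕ) = (|κ m| - b) / |κ m| := by
      rw [hκabs]
      field_simp
      ring
    rw [h5, inv_div, div_eq_mul_inv]
  have hlim : Tendsto (fun m : ℕ =>
      Real.exp c₁ * ((1 + (-(b * |t|)) / (m + 1 : ℕ)) ^ (m + 1))⁻¹ * Real.exp c₂) atTop
      (𝓝 (Real.exp (b * |t| + c₁ + c₂))) := by
    have h1 := (Real.tendsto_one_add_div_pow_exp (-(b * |t|))).comp (tendsto_add_atTop_nat 1)
    have h2 := ((h1.inv₀ (Real.exp_pos _).ne').const_mul (Real.exp c₁)).mul_const (Real.exp c₂)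
    have e : Real.exp c₁ * (Real.exp (-(b * |t|)))⁻¹ * Real.exp c₂ =
        Real.exp (b * |t| + c₁ + c₂) := by
      rw [← Real.exp_neg, neg_neg, ← Real.exp_add, ← Real.exp_add]
      congr 1
      ring
    rw [e] at h2
    exact h2
  refine ContinuousLinearMap.opNorm_le_bound _ (Real.exp_pos _).le fun ψ => ?_
  have h1 := hU.tendsto_pow hH ht hκ hR (chi Q hQ ψ)
  have h2 := (((chi P hP).continuous.tendsto _).comp h1).norm
  refine le_of_tendsto_of_tendsto h2 (hlim.mul_const ‖ψ‖) ?_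
  filter_upwards [hbound] with m hm
  exact ContinuousLinearMap.le_of_opNorm_le _ hm ψ

end Translation

/-! ### A Schur test for operators -/

section Schur

variable {E : Type*} [NormedAddCommGroup E] [InnerProductSpace ℂ E]
variable {ι : Type*} {P : ι → E →L[ℂ] E}

theorem sum_norm_sq_eq (hidem : ∀ i, P i * P i = P i)
    (hsa : ∀ i φ ψ, inner ℂ (P i φ) ψ = inner ℂ φ (P i ψ)) (F : Finset ι) (ψ : E) :
    ((∑ i ∈ F, ‖P i ψ‖ ^ 2 : ℝ) : ℂ) = inner ℂ ψ ((∑ i ∈ F, P i) ψ) := by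
  rw [sum_apply, inner_sum]
  push_cast
  refine Finset.sum_congr rfl fun i _ => ?_
  have : P i ψ = P i (P i ψ) := by rw [← mul_apply_eq_comp, hidem]
  rw [this, ← hsa, inner_self_eq_norm_sq_to_K, ← this]
  rfl

theorem norm_sum_apply_sq (hidem : ∀ i, P i * P i = P i)
    (hsa : ∀ i φ ψ, inner ℂ (P i φ) ψ = inner ℂ φ (P i ψ))
    (horth : ∀ i j, i ≠ j → P i * P j = 0) (F : Finset ι) (ψ : E) :
    ‖(∑ i ∈ F, P i) ψ‖ ^ 2 = ∑ i ∈ F, ‖P i ψ‖ ^ 2 := by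
  classical
  have hPF : (∑ i ∈ F, P i) ((∑ i ∈ F, P i) ψ) = (∑ i ∈ F, P i) ψ := by
    simp only [sum_apply, map_sum]
    refine Finset.sum_congr rfl fun i hi => ?_
    rw [Finset.sum_eq_single i (fun j _ hij => by
      rw [← mul_apply_eq_comp, horth _ _ hij, zero_apply]) (fun h => absurd hi h),
      ← mul_apply_eq_comp, hidem]
  have hFsa (χ : E) : inner ℂ ((∑ i ∈ F, P i) ψ) χ = inner ℂ ψ ((∑ i ∈ F, P i) χ) := by
    simp only [sum_apply, sum_inner, inner_sum, hsa]
  have h := hFsa ((∑ i ∈ F, P i) ψ)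
  rw [hPF, ← sum_norm_sq_eq hidem hsa, inner_self_eq_norm_sq_to_K] at h
  refine Complex.ofReal_injective ?_
  rw [← h]
  exact Complex.ofReal_pow _ _

theorem norm_sum_apply_le (hidem : ∀ i, P i * P i = P i)
    (hsa : ∀ i φ ψ, inner ℂ (P i φ) ψ = inner ℂ φ (P i ψ))
    (horth : ∀ i j, i ≠ j → P i * P j = 0) (F : Finset ι) (ψ : E) :
    ‖(∑ i ∈ F, P i) ψ‖ ≤ ‖ψ‖ := by
  have h1 := norm_sum_apply_sq hidem hsa horth F ψ
  have h2 : ‖(∑ i ∈ F, P i) ψ‖ ^ 2 ≤ ‖ψ‖ * ‖(∑ i ∈ F, P i) ψ‖ := by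
    have h3 : ‖((∑ i ∈ F, ‖P i ψ‖ ^ 2 : ℝ) : ℂ)‖ ≤ ‖ψ‖ * ‖(∑ i ∈ F, P i) ψ‖ := by
      rw [sum_norm_sq_eq hidem hsa]
      exact norm_inner_le_norm _ _
    rw [Complex.norm_real, ← h1, Real.norm_eq_abs, abs_of_nonneg (sq_nonneg _)] at h3
    exact h3
  rcases (norm_nonneg ((∑ i ∈ F, P i) ψ)).eq_or_lt with h0 | h0
  · rw [← h0]
    exact norm_nonneg _
  · rw [sq] at h2
    exact le_of_mul_le_mul_right h2 h0

/-- A complete family of orthogonal projections sums to the identity. -/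
theorem tendsto_sum_projections [CompleteSpace E] (hidem : ∀ i, P i * P i = P i)
    (hsa : ∀ i φ ψ, inner ℂ (P i φ) ψ = inner ℂ φ (P i ψ))
    (horth : ∀ i j, i ≠ j → P i * P j = 0) (hcomp : ∀ ψ, (∀ i, P i ψ = 0) → ψ = 0) (ψ : E) :
    Tendsto (fun F : Finset ι => (∑ i ∈ F, P i) ψ) atTop (𝓝 ψ) := by
  classical
  let s : Submodule ℂ E :=
    { carrier := {ψ | Tendsto (fun F : Finset ι => (∑ i ∈ F, P i) ψ) atTop (𝓝 ψ)}
      add_mem' := fun {φ χ} hφ hχ => by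
        have : Tendsto _ _ _ := Tendsto.add hφ hχ
        simpa only [Set.mem_ofPred_eq, map_add] using this
      zero_mem' := by simp
      smul_mem' := fun c φ hφ => by
        have : Tendsto _ _ _ := Tendsto.const_smul hφ c
        simpa only [Set.mem_ofPred_eq, map_smul] using this }
  have hmem (i : ι) (φ : E) : P i φ ∈ s := by
    refine tendsto_const_nhds.congr' ?_
    filter_upwards [eventually_ge_atTop {i}] with F hF
    have hi : i ∈ F := hF (Finset.mem_singleton_self i)
    rw [sum_apply, Finset.sum_eq_single i (fun j _ hij => by
      rw [← mul_apply_eq_comp, horth _ _ hij, zero_apply]) (fun h => absurd hi h),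
      ← mul_apply_eq_comp, hidem]
  have hs : Dense (s : Set E) := by
    rw [Submodule.dense_iff_topologicalClosure_eq_top, Submodule.topologicalClosure_eq_top_iff,
      Submodule.eq_bot_iff]
    refine fun φ hφ => hcomp φ fun i => ?_
    have h1 := (Submodule.mem_orthogonal' _ _).1 hφ _ (hmem i (P i φ))
    rwa [← hsa, inner_self_eq_zero] at h1
  refine tendsto_apply_of_dense (B := 1) (fun F => ?_) hs (fun χ hχ => hχ) ψ
  exact ContinuousLinearMap.opNorm_le_bound _ zero_le_one fun χ => by
    rw [one_mul]
    exact norm_sum_apply_le hidem hsa horth F χ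

/-- **Schur test**: an operator whose blocks with respect to a complete family of orthogonal
projections are bounded by a kernel `k` with row and column sums at most `S` has norm at most
`S`. -/
theorem norm_le_of_schur [CompleteSpace E] (hidem : ∀ i, P i * P i = P i)
    (hsa : ∀ i φ ψ, inner ℂ (P i φ) ψ = inner ℂ φ (P i ψ))
    (horth : ∀ i j, i ≠ j → P i * P j = 0) (hcomp : ∀ ψ, (∀ i, P i ψ = 0) → ψ = 0)
    {V : E →L[ℂ] E} {k : ι → ι → ℝ} (hk : ∀ i j, ‖P i * V * P j‖ ≤ k i j) {S : ℝ} (hS : 0 ≤ S)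
    (hrow : ∀ (F : Finset ι) (i : ι), ∑ j ∈ F, k i j ≤ S)
    (hcol : ∀ (F : Finset ι) (j : ι), ∑ i ∈ F, k i j ≤ S) : ‖V‖ ≤ S := by
  have hfin (F : Finset ι) (φ ψ : E) :
      ‖inner ℂ ((∑ i ∈ F, P i) φ) (V ((∑ i ∈ F, P i) ψ))‖ ≤
        S * ((‖φ‖ ^ 2 + ‖ψ‖ ^ 2) / 2) := by
    have hblock (i j : ι) : ‖inner ℂ (P i φ) (V (P j ψ))‖ ≤
        k i j * ‖P i φ‖ ^ 2 / 2 + k i j * ‖P j ψ‖ ^ 2 / 2 := by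
      have e : inner ℂ (P i φ) (V (P j ψ)) = inner ℂ (P i φ) ((P i * V * P j) (P j ψ)) := by
        rw [mul_apply_eq_comp, mul_apply_eq_comp, ← hsa, ← mul_apply_eq_comp (P i), hidem,
          ← mul_apply_eq_comp (P j), hidem]
      have h1 : ‖inner ℂ (P i φ) (V (P j ψ))‖ ≤ ‖P i φ‖ * (k i j * ‖P j ψ‖) := by
        rw [e]
        exact (norm_inner_le_norm _ _).trans (mul_le_mul_of_nonneg_left
          (ContinuousLinearMap.le_of_opNorm_le _ (hk i j) _) (norm_nonneg _))
      have h0 : 0 ≤ k i j := (norm_nonneg _).trans (hk i j)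
      nlinarith [mul_nonneg h0 (sq_nonneg (‖P i φ‖ - ‖P j ψ‖))]
    have hsq (χ : E) : ∑ i ∈ F, ‖P i χ‖ ^ 2 ≤ ‖χ‖ ^ 2 := by
      rw [← norm_sum_apply_sq hidem hsa horth]
      exact pow_le_pow_left₀ (norm_nonneg _) (norm_sum_apply_le hidem hsa horth F χ) 2
    have e1 : inner ℂ ((∑ i ∈ F, P i) φ) (V ((∑ i ∈ F, P i) ψ)) =
        ∑ i ∈ F, ∑ j ∈ F, inner ℂ (P i φ) (V (P j ψ)) := by
      simp only [sum_apply, map_sum, sum_inner, inner_sum]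
      exact Finset.sum_comm
    have h1 : ∑ i ∈ F, ∑ j ∈ F, k i j * ‖P i φ‖ ^ 2 / 2 ≤ S * ‖φ‖ ^ 2 / 2 := by
      calc ∑ i ∈ F, ∑ j ∈ F, k i j * ‖P i φ‖ ^ 2 / 2
          = ∑ i ∈ F, (∑ j ∈ F, k i j) * (‖P i φ‖ ^ 2 / 2) := by
            simp only [Finset.sum_mul, mul_div_assoc]
        _ ≤ ∑ i ∈ F, S * (‖P i φ‖ ^ 2 / 2) := Finset.sum_le_sum fun i _ =>
            mul_le_mul_of_nonneg_right (hrow F i) (by positivity)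
        _ = S * (∑ i ∈ F, ‖P i φ‖ ^ 2) / 2 := by
            rw [← Finset.mul_sum, ← Finset.sum_div, mul_div_assoc]
        _ ≤ _ := by
            have := mul_le_mul_of_nonneg_left (hsq φ) hS
            linarith
    have h2 : ∑ i ∈ F, ∑ j ∈ F, k i j * ‖P j ψ‖ ^ 2 / 2 ≤ S * ‖ψ‖ ^ 2 / 2 := by
      rw [Finset.sum_comm]
      calc ∑ j ∈ F, ∑ i ∈ F, k i j * ‖P j ψ‖ ^ 2 / 2
          = ∑ j ∈ F, (∑ i ∈ F, k i j) * (‖P j ψ‖ ^ 2 / 2) := by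
            simp only [Finset.sum_mul, mul_div_assoc]
        _ ≤ ∑ j ∈ F, S * (‖P j ψ‖ ^ 2 / 2) := Finset.sum_le_sum fun j _ =>
            mul_le_mul_of_nonneg_right (hcol F j) (by positivity)
        _ = S * (∑ j ∈ F, ‖P j ψ‖ ^ 2) / 2 := by
            rw [← Finset.mul_sum, ← Finset.sum_div, mul_div_assoc]
        _ ≤ _ := by
            have := mul_le_mul_of_nonneg_left (hsq ψ) hS
            linarith
    rw [e1]
    refine (norm_sum_le _ _).trans ((Finset.sum_le_sum fun i _ => (norm_sum_le _ _).trans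
      (Finset.sum_le_sum fun j _ => hblock i j)).trans ?_)
    simp only [Finset.sum_add_distrib]
    linarith
  have hform (φ ψ : E) : ‖inner ℂ φ (V ψ)‖ ≤ S * ((‖φ‖ ^ 2 + ‖ψ‖ ^ 2) / 2) := by
    have h1 := tendsto_sum_projections hidem hsa horth hcomp φ
    have h2 := (V.continuous.tendsto _).comp (tendsto_sum_projections hidem hsa horth hcomp ψ)
    exact le_of_tendsto (h1.inner h2).norm (Eventually.of_forall fun F => hfin F φ ψ)
  refine V.opNorm_le_bound hS fun ψ => ?_
  rcases eq_or_ne ψ 0 with rfl | hψ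
  · simp
  rcases eq_or_ne (V ψ) 0 with hV | hV
  · rw [hV, norm_zero]
    positivity
  have hV' : ‖V ψ‖ ≠ 0 := norm_ne_zero_iff.2 hV
  -- the vector parallel to `V ψ` that is as long as `ψ`
  have h := hform (((‖ψ‖ / ‖V ψ‖ : ℝ) : ℂ) • V ψ) ψ
  rw [inner_smul_left, norm_mul, norm_smul, inner_self_eq_norm_sq_to_K] at h
  simp only [Complex.conj_ofReal, Complex.norm_real, norm_pow, norm_div, norm_norm,
    RCLike.norm_ofReal, abs_norm] at h
  have e1 : ‖ψ‖ / ‖V ψ‖ * ‖V ψ‖ = ‖ψ‖ := div_mul_cancel₀ _ hV'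
  have e2 : ‖ψ‖ / ‖V ψ‖ * ‖V ψ‖ ^ 2 = ‖ψ‖ * ‖V ψ‖ := by rw [sq, ← mul_assoc, e1]
  rw [e1, e2] at h
  refine le_of_mul_le_mul_left ?_ (norm_pos_iff.2 hψ)
  linarith

end Schur

/-! ### The cubic lattice -/

section Lattice

variable {n : ℕ}

/-- The lattice point `k ∈ ℤⁿ`, as a vector in `ℝⁿ`. -/
def latticePoint (k : Fin n → ℤ) : Space n := WithLp.toLp 2 fun i => (k i : ℝ)

theorem latticePoint_sub (j k : Fin n → ℤ) :
    latticePoint (j - k) = latticePoint j - latticePoint k := by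
  ext i
  simp [latticePoint]

theorem summable_exp_neg_mul_abs_int {r : ℝ} (hr : 0 < r) :
    Summable fun k : ℤ => Real.exp (-(r * |(k : ℝ)|)) := by
  have h : Summable fun m : ℕ => Real.exp (-(r * (m : ℝ))) := by
    refine (summable_geometric_of_lt_one (Real.exp_pos (-r)).le
      (Real.exp_lt_one_iff.2 (neg_lt_zero.2 hr))).congr fun m => ?_
    rw [← Real.exp_nat_mul]
    congr 1
    ring
  refine Summable.of_nat_of_neg ?_ ?_
  · simpa using h
  · simpa using h

theorem summable_prod_of_nonneg {g : ℤ → ℝ} (hg : Summable g) (hg0 : ∀ k, 0 ≤ g k) :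
    Summable fun k : Fin n → ℤ => ∏ i, g (k i) := by
  classical
  refine summable_of_sum_le (c := ∏ _i : Fin n, ∑' m, g m)
    (fun k => Finset.prod_nonneg fun i _ => hg0 _) fun F => ?_
  calc ∑ k ∈ F, ∏ i, g (k i)
      ≤ ∑ k ∈ Fintype.piFinset fun i => F.image fun k => k i, ∏ i, g (k i) := by
        refine Finset.sum_le_sum_of_subset_of_nonneg (fun k hk => ?_)
          fun k _ _ => Finset.prod_nonneg fun i _ => hg0 _
        exact Fintype.mem_piFinset.2 fun i => Finset.mem_image_of_mem _ hk
    _ = ∏ i, ∑ m ∈ F.image (fun k => k i), g m := (Finset.prod_univ_sum _ _).symm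
    _ ≤ _ := Finset.prod_le_prod (fun i _ => Finset.sum_nonneg fun m _ => hg0 m)
        fun i _ => hg.sum_le_tsum _ fun m _ => hg0 m

theorem summable_exp_neg_norm_latticePoint :
    Summable fun k : Fin n → ℤ => Real.exp (-‖latticePoint k‖) := by
  rcases n.eq_zero_or_pos with rfl | hn
  · exact Summable.of_finite
  have hn' : (0 : ℝ) < n := by exact_mod_cast hn
  refine Summable.of_nonneg_of_le (fun k => (Real.exp_pos _).le) (fun k => ?_)
    (summable_prod_of_nonneg (summable_exp_neg_mul_abs_int (inv_pos.2 hn'))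
      fun k => (Real.exp_pos _).le)
  rw [← Real.exp_sum, Real.exp_le_exp, Finset.sum_neg_distrib, neg_le_neg_iff]
  calc ∑ i, (n : ℝ)⁻¹ * |(k i : ℝ)| ≤ ∑ _i : Fin n, (n : ℝ)⁻¹ * ‖latticePoint k‖ :=
        Finset.sum_le_sum fun i _ => mul_le_mul_of_nonneg_left
          (PiLp.norm_apply_le (latticePoint k) i) (inv_pos.2 hn').le
    _ = ‖latticePoint k‖ := by
        rw [Finset.sum_const, Finset.card_univ, Fintype.card_fin, nsmul_eq_mul, ← mul_assoc,
          mul_inv_cancel₀ hn'.ne', one_mul]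

/-- The half-open cube of side `ℓ` with corner `ℓ k`. -/
def cell (ℓ : ℝ) (k : Fin n → ℤ) : Set (Space n) := {x | ∀ i, ⌊x i / ℓ⌋ = k i}

theorem measurableSet_cell (ℓ : ℝ) (k : Fin n → ℤ) : MeasurableSet (cell ℓ k) := by
  have : cell ℓ k = ⋂ i, (fun x : Space n => ⌊x i / ℓ⌋) ⁻¹' {k i} := by
    ext x
    simp [cell]
  rw [this]
  refine MeasurableSet.iInter fun i => ?_
  have h : Measurable fun x : Space n => x i / ℓ := Continuous.measurable (by fun_prop)
  exact (Int.measurable_floor.comp h) (measurableSet_singleton _)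

theorem cell_inter_of_ne {ℓ : ℝ} {j k : Fin n → ℤ} (h : j ≠ k) : cell ℓ j ∩ cell ℓ k = ∅ := by
  ext x
  simp only [Set.mem_inter_iff, Set.mem_empty_iff_false, iff_false, not_and]
  exact fun hj hk => h (funext fun i => (hj i).symm.trans (hk i))

theorem norm_sub_le_of_mem_cell {ℓ : ℝ} (hℓ : 0 < ℓ) {k : Fin n → ℤ} {x : Space n}
    (hx : x ∈ cell ℓ k) : ‖x - ℓ • latticePoint k‖ ≤ ℓ * √n := by
  have h (i : Fin n) : ‖(x - ℓ • latticePoint k) i‖ ^ 2 ≤ ℓ ^ 2 := by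
    have h1 := Int.floor_le (x i / ℓ)
    have h2 := Int.lt_floor_add_one (x i / ℓ)
    rw [hx i] at h1 h2
    rw [le_div_iff₀ hℓ] at h1
    rw [div_lt_iff₀ hℓ] at h2
    have e : (x - ℓ • latticePoint k) i = x i - ℓ * k i := by simp [latticePoint]
    rw [e, Real.norm_eq_abs, sq_abs]
    nlinarith
  rw [EuclideanSpace.norm_eq]
  refine Real.sqrt_le_iff.2 ⟨by positivity, ?_⟩
  rw [mul_pow, Real.sq_sqrt (Nat.cast_nonneg n)]
  refine (Finset.sum_le_sum fun i _ => h i).trans (le_of_eq ?_)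
  rw [Finset.sum_const, Finset.card_univ, Fintype.card_fin, nsmul_eq_mul, mul_comm]

theorem isBounded_cell {ℓ : ℝ} (hℓ : 0 < ℓ) (k : Fin n → ℤ) : Bornology.IsBounded (cell ℓ k) := by
  refine Metric.isBounded_closedBall.subset (s := cell ℓ k)
    (t := Metric.closedBall (ℓ • latticePoint k) (ℓ * √n)) fun x hx => ?_
  rw [Metric.mem_closedBall, dist_eq_norm]
  exact norm_sub_le_of_mem_cell hℓ hx

theorem inner_chi_left {X : Set (Space n)} (hX : MeasurableSet X) (φ ψ : L2 n) :
    inner ℂ (chi X hX φ) ψ = inner ℂ φ (chi X hX ψ) := by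
  rw [L2.inner_def, L2.inner_def]
  refine integral_congr_ae ?_
  filter_upwards [mulOp_apply_ae _ (memLp_indicator hX) φ,
    mulOp_apply_ae _ (memLp_indicator hX) ψ] with x h1 h2
  change inner ℂ (mulOp _ (memLp_indicator hX) φ x) (ψ x) =
    inner ℂ (φ x) (mulOp _ (memLp_indicator hX) ψ x)
  rw [h1, h2]
  by_cases hx : x ∈ X <;> simp [hx]

theorem eq_zero_of_chi_cell_eq_zero (ℓ : ℝ) {ψ : L2 n}
    (h : ∀ k, chi (cell ℓ k) (measurableSet_cell ℓ k) ψ = 0) : ψ = 0 := by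
  have h1 : ∀ k : Fin n → ℤ, ∀ᵐ x : Space n,
      (cell ℓ k).indicator (fun _ => (1 : ℂ)) x * ψ x = 0 := by
    intro k
    filter_upwards [mulOp_apply_ae _ (memLp_indicator (measurableSet_cell ℓ k)) ψ,
      Lp.coeFn_zero ℂ 2 (volume : Measure (Space n))] with x h2 h3
    rw [← h2]
    have h4 : mulOp _ (memLp_indicator (measurableSet_cell ℓ k)) ψ = 0 := h k
    rw [h4, h3, Pi.zero_apply]
  apply Lp.ext
  filter_upwards [ae_all_iff.2 h1, Lp.coeFn_zero ℂ 2 (volume : Measure (Space n))] with x h2 h3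
  rw [h3, Pi.zero_apply]
  have h4 : x ∈ cell ℓ fun i => ⌊x i / ℓ⌋ := fun i => rfl
  simpa [h4] using h2 fun i => ⌊x i / ℓ⌋

end Lattice

/-! ### Decay of the propagator between separated sets -/

section Decay

variable {n : ℕ}

theorem setDist_le_dist {X Y : Set (Space n)} {x y : Space n} (hx : x ∈ X) (hy : y ∈ Y) :
    setDist X Y ≤ dist x y :=
  csInf_le ⟨0, by rintro _ ⟨_, _, _, _, rfl⟩; exact dist_nonneg⟩ (Set.mem_image2_of_mem hx hy)

theorem setDist_comm (X Y : Set (Space n)) : setDist X Y = setDist Y X := by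
  rw [setDist, setDist, Set.image2_swap]
  simp only [dist_comm]

theorem inter_eq_empty_of_setDist_pos {X Y : Set (Space n)} (h : 0 < setDist X Y) :
    X ∩ Y = ∅ := by
  rw [Set.eq_empty_iff_forall_notMem]
  rintro x ⟨hx, hy⟩
  have := setDist_le_dist hx hy
  rw [dist_self] at this
  exact absurd h this.not_gt

theorem mul_mul_mul_mul_assoc {R : Type*} [Monoid R] (p x u y q : R) :
    p * (x * u * y) * q = p * x * u * (y * q) := by
  simp only [mul_assoc]

theorem exists_norm_le_one_inner_eq_norm (e : Space n) :
    ∃ v : Space n, ‖v‖ ≤ 1 ∧ inner ℝ v e = ‖e‖ := by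
  rcases eq_or_ne e 0 with rfl | he
  · exact ⟨0, by simp, by simp⟩
  · have h : ‖e‖ ≠ 0 := norm_ne_zero_iff.2 he
    refine ⟨‖e‖⁻¹ • e, ?_, ?_⟩
    · rw [norm_smul, norm_inv, norm_norm, inv_mul_cancel₀ h]
    · rw [inner_smul_left, real_inner_self_eq_norm_sq, sq]
      exact inv_mul_cancel_left₀ h _

theorem abs_inner_sub_le_of_mem_cell {ℓ : ℝ} (hℓ : 0 < ℓ) {k : Fin n → ℤ} {x v : Space n}
    (hv : ‖v‖ ≤ 1) (hx : x ∈ cell ℓ k) :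
    |inner ℝ v x - ℓ * inner ℝ v (latticePoint k)| ≤ ℓ * √n := by
  rw [← inner_smul_right, ← inner_sub_right]
  exact (abs_real_inner_le_norm _ _).trans ((mul_le_of_le_one_left (norm_nonneg _) hv).trans
    (norm_sub_le_of_mem_cell hℓ hx))

/-- The sum `∑_{k ∈ ℤⁿ} e^{-|k|}`. -/
def latticeSum (n : ℕ) : ℝ := ∑' k : Fin n → ℤ, Real.exp (-‖latticePoint k‖)

theorem latticeSum_pos (n : ℕ) : 0 < latticeSum n :=
  summable_exp_neg_norm_latticePoint.tsum_pos (fun _ => (Real.exp_pos _).le) 0 (Real.exp_pos _)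

theorem sum_exp_neg_le_latticeSum (F : Finset (Fin n → ℤ)) (i : Fin n → ℤ) :
    ∑ j ∈ F, Real.exp (-‖latticePoint i - latticePoint j‖) ≤ latticeSum n := by
  have hs := summable_exp_neg_norm_latticePoint (n := n)
  have h1 := ((Equiv.subLeft i).summable_iff.2 hs).sum_le_tsum F fun _ _ => (Real.exp_pos _).le
  rw [(Equiv.subLeft i).tsum_eq (fun k => Real.exp (-‖latticePoint k‖))] at h1
  rw [latticeSum]
  simpa only [Function.comp, Equiv.subLeft_apply, latticePoint_sub] using h1

/-- The decay of the blocks of the propagator with respect to the cubes of side `ℓ`, where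
`ℓ (μ' - μ) = 1`: the surplus `μ' - μ` of the rate over `μ` makes the blocks summable. -/
theorem norm_chi_cell_inter_le {U : L2 n →L[ℂ] L2 n} {B μ μ' ℓ : ℝ} (hμ : 0 < μ) (hμμ' : μ < μ')
    (hℓ : ℓ * (μ' - μ) = 1)
    (hU : ∀ v : Space n, ‖v‖ ≤ 1 → ∀ (P Q : Set (Space n)) (hP : MeasurableSet P)
      (hQ : MeasurableSet Q), Bornology.IsBounded P → Bornology.IsBounded Q → ∀ c₁ c₂ : ℝ,
      (∀ x ∈ P, -μ' * inner ℝ v x ≤ c₁) → (∀ y ∈ Q, μ' * inner ℝ v y ≤ c₂) →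
        ‖chi P hP * U * chi Q hQ‖ ≤ Real.exp (B + c₁ + c₂))
    {X Y : Set (Space n)} (hX : MeasurableSet X) (hY : MeasurableSet Y) (j k : Fin n → ℤ) :
    ‖chi (cell ℓ j ∩ X) ((measurableSet_cell ℓ j).inter hX) * U *
        chi (Y ∩ cell ℓ k) (hY.inter (measurableSet_cell ℓ k))‖ ≤
      Real.exp (4 * √n * (ℓ * μ')) * Real.exp (-μ * setDist X Y + B) *
        Real.exp (-‖latticePoint j - latticePoint k‖) := by
  have hμ' : 0 < μ' := hμ.trans hμμ'
  have hℓ0 : 0 < ℓ := pos_of_mul_pos_left (hℓ.symm ▸ one_pos) (sub_pos.2 hμμ').le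
  rcases (cell ℓ j ∩ X).eq_empty_or_nonempty with h0 | ⟨x₀, hx₀⟩
  · have : chi (cell ℓ j ∩ X) ((measurableSet_cell ℓ j).inter hX) = 0 := by
      simp only [h0, chi_empty]
    rw [this, zero_mul, zero_mul, norm_zero]
    positivity
  rcases (Y ∩ cell ℓ k).eq_empty_or_nonempty with h0 | ⟨y₀, hy₀⟩
  · have : chi (Y ∩ cell ℓ k) (hY.inter (measurableSet_cell ℓ k)) = 0 := by
      simp only [h0, chi_empty]
    rw [this, mul_zero, norm_zero]
    positivity
  set e := latticePoint j - latticePoint k with he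
  obtain ⟨v, hv, hve⟩ := exists_norm_le_one_inner_eq_norm e
  have h := hU v hv _ _ ((measurableSet_cell ℓ j).inter hX) (hY.inter (measurableSet_cell ℓ k))
    ((isBounded_cell hℓ0 j).subset Set.inter_subset_left)
    ((isBounded_cell hℓ0 k).subset Set.inter_subset_right)
    (-μ' * (ℓ * inner ℝ v (latticePoint j)) + μ' * (ℓ * √n))
    (μ' * (ℓ * inner ℝ v (latticePoint k)) + μ' * (ℓ * √n))
    (fun x hx => by
      have := (abs_le.1 (abs_inner_sub_le_of_mem_cell hℓ0 hv hx.1)).1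
      nlinarith)
    (fun y hy => by
      have := (abs_le.1 (abs_inner_sub_le_of_mem_cell hℓ0 hv hy.2)).2
      nlinarith)
  refine h.trans ?_
  rw [← Real.exp_add, ← Real.exp_add, Real.exp_le_exp]
  have hd : setDist X Y ≤ ℓ * ‖e‖ + 2 * (ℓ * √n) := by
    refine (setDist_le_dist hx₀.2 hy₀.1).trans ?_
    have e1 : x₀ - y₀ = (x₀ - ℓ • latticePoint j) - (y₀ - ℓ • latticePoint k) + ℓ • e := by
      rw [he, smul_sub]; abel
    rw [dist_eq_norm, e1]
    refine (norm_add_le _ _).trans ?_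
    rw [norm_smul, Real.norm_eq_abs, abs_of_pos hℓ0]
    have h1 := norm_sub_le (x₀ - ℓ • latticePoint j) (y₀ - ℓ • latticePoint k)
    have h2 := norm_sub_le_of_mem_cell hℓ0 hx₀.1
    have h3 := norm_sub_le_of_mem_cell hℓ0 hy₀.2
    linarith
  have hinner : inner ℝ v (latticePoint j) - inner ℝ v (latticePoint k) = ‖e‖ := by
    rw [← inner_sub_right, hve]
  have hμd := mul_le_mul_of_nonneg_left hd hμ.le
  have hs : μ * (ℓ * √n) ≤ μ' * (ℓ * √n) :=
    mul_le_mul_of_nonneg_right hμμ'.le (by positivity)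
  have e2 : μ' * ℓ * ‖e‖ = μ * ℓ * ‖e‖ + ‖e‖ := by linear_combination ‖e‖ * hℓ
  have e3 : -μ' * (ℓ * inner ℝ v (latticePoint j)) + μ' * (ℓ * inner ℝ v (latticePoint k)) =
      -(μ' * ℓ * ‖e‖) := by rw [← hinner]; ring
  linarith

/-- Exponential decay of the propagator between separated sets. -/
theorem ConditionA.exists_norm_chi_propagator_chi_le_exp_setDist {H : L2 n →ₗ.[ℂ] L2 n}
    (hH : IsSelfAdjoint H) {a : ℝ} (h : ConditionA H a) {μ : ℝ} (hμ : 0 < μ) (hμa : μ < a) :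
    ∃ b : ℝ, 0 ≤ b ∧ ∀ (X Y : Set (Space n)) (hX : MeasurableSet X) (hY : MeasurableSet Y),
      0 < setDist X Y → ∀ t : ℝ, ‖chi X hX * propagator H t * chi Y hY‖ ≤
        latticeSum n * Real.exp (4 * √n * ((a + μ) / (a - μ))) *
          Real.exp (-μ * setDist X Y + b * |t|) := by
  have hμ' : 0 < (a + μ) / 2 := by linarith
  have hμμ' : μ < (a + μ) / 2 := by linarith
  have haμ : a - μ ≠ 0 := (sub_pos.2 hμa).ne'
  obtain ⟨b, hb0, hb⟩ := h.exists_norm_chi_propagator_chi_le hH hμ'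
    (show (a + μ) / 2 < a by linarith)
  refine ⟨b, hb0, fun X Y hX hY hd t => ?_⟩
  have hS := latticeSum_pos n
  rcases eq_or_ne t 0 with rfl | ht
  · rw [(isUnitaryGroupOf_propagator hH).map_zero, mul_one, chi_mul_chi hX hY MeasurableSet.empty
      (inter_eq_empty_of_setDist_pos hd), chi_empty, norm_zero]
    positivity
  set ℓ := 2 / (a - μ) with hℓ
  have hℓ1 : ℓ * ((a + μ) / 2 - μ) = 1 := by
    rw [hℓ]
    field_simp
    ring
  have hℓ2 : ℓ * ((a + μ) / 2) = (a + μ) / (a - μ) := by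
    rw [hℓ]
    field_simp
  set D := Real.exp (4 * √n * ((a + μ) / (a - μ))) * Real.exp (-μ * setDist X Y + b * |t|) with hD
  have hblock (j k : Fin n → ℤ) : ‖chi (cell ℓ j) (measurableSet_cell ℓ j) *
      (chi X hX * propagator H t * chi Y hY) * chi (cell ℓ k) (measurableSet_cell ℓ k)‖ ≤
      D * Real.exp (-‖latticePoint j - latticePoint k‖) := by
    rw [mul_mul_mul_mul_assoc, chi_mul_chi (measurableSet_cell ℓ j) hX _ rfl,
      chi_mul_chi hY (measurableSet_cell ℓ k) _ rfl, hD, ← hℓ2]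
    exact norm_chi_cell_inter_le hμ hμμ' hℓ1
      (fun v hv P Q hP hQ hPb hQb c₁ c₂ h1 h2 => hb v hv P Q hP hQ hPb hQb c₁ c₂ h1 h2 t ht)
      hX hY j k
  have hD0 : 0 ≤ D := by positivity
  have hsum (F : Finset (Fin n → ℤ)) (i : Fin n → ℤ) :
      ∑ j ∈ F, D * Real.exp (-‖latticePoint i - latticePoint j‖) ≤ D * latticeSum n := by
    rw [← Finset.mul_sum]
    exact mul_le_mul_of_nonneg_left (sum_exp_neg_le_latticeSum F i) hD0
  refine (norm_le_of_schur (P := fun k => chi (cell ℓ k) (measurableSet_cell ℓ k))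
    (fun k => chi_mul_chi _ _ _ (Set.inter_self _)) (fun k => inner_chi_left _)
    (fun j k hjk => (chi_mul_chi _ _ MeasurableSet.empty (cell_inter_of_ne hjk)).trans chi_empty)
    (fun ψ => eq_zero_of_chi_cell_eq_zero ℓ) hblock (mul_nonneg hD0 hS.le) hsum
    (fun F i => ?_)).trans (le_of_eq ?_)
  · simpa only [norm_sub_rev] using hsum F i
  · rw [hD]
    ring

end Decay

/-! ### Commutators of localized operators -/

section Commutator

theorem norm_mul_comm_sub_le {R : Type*} [NormedRing R] {u u' p q A B : R} {δ α β : ℝ}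
    (huu : u' * u = 1) (hu : ‖u‖ ≤ 1) (hu' : ‖u'‖ ≤ 1) (hp : ‖p‖ ≤ 1) (hq : ‖q‖ ≤ 1)
    (hA : A - 1 = p * (A - 1) * p) (hB : B - 1 = q * (B - 1) * q) (h1 : ‖p * u * q‖ ≤ δ)
    (h2 : ‖q * u' * p‖ ≤ δ) (hα : ‖A - 1‖ ≤ α) (hβ : ‖B - 1‖ ≤ β) :
    ‖u' * A * u * B - B * (u' * A * u)‖ ≤ 2 * (δ * α * β) := by
  have hα0 := (norm_nonneg _).trans hα
  have hβ0 := (norm_nonneg _).trans hβ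
  have hδ0 := (norm_nonneg _).trans h1
  have e : u' * A * u * B - B * (u' * A * u) =
      u' * p * ((A - 1) * (p * u * q) * (B - 1)) * q -
        q * ((B - 1) * (q * u' * p) * (A - 1)) * (p * u) := by
    have e1 : u' * A * u = u' * (A - 1) * u + 1 := by
      rw [mul_sub, sub_mul, mul_one, huu, sub_add_cancel]
    calc u' * A * u * B - B * (u' * A * u)
        = u' * (A - 1) * u * (B - 1) - (B - 1) * (u' * (A - 1) * u) := by
          rw [e1]; noncomm_ring
      _ = u' * (p * (A - 1) * p) * u * (q * (B - 1) * q) -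
          q * (B - 1) * q * (u' * (p * (A - 1) * p) * u) := by rw [← hA, ← hB]
      _ = _ := by simp only [mul_assoc]
  have hup : ‖u' * p‖ ≤ 1 := (norm_mul_le _ _).trans (mul_le_one₀ hu' (norm_nonneg _) hp)
  have hpu : ‖p * u‖ ≤ 1 := (norm_mul_le _ _).trans (mul_le_one₀ hp (norm_nonneg _) hu)
  have b1 := norm_mul_mul_le hup (norm_mul_mul_le hα h1 hβ) hq
  have b2 := norm_mul_mul_le hq (norm_mul_mul_le hβ h2 hα) hpu
  rw [e]
  refine (norm_sub_le _ _).trans ((add_le_add b1 b2).trans (le_of_eq ?_))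
  ring

variable {n : ℕ} {A B : L2 n →L[ℂ] L2 n} {X Y : Set (Space n)} {hX : MeasurableSet X}
  {hY : MeasurableSet Y}

theorem ActsOn.sub_one_eq (h : ActsOn A X hX) :
    A - 1 = chi X hX * (A - 1) * chi X hX := by
  have key {R : Type} [Ring R] {x p : R} (hp : p * p = p) (hx : x = p * (x * p) + (1 - p)) :
      x - 1 = p * (x - 1) * p := by
    rw [mul_sub, sub_mul, mul_one, hp, mul_assoc]
    nth_rw 1 [hx]
    abel
  refine key (chi_mul_chi hX hX hX (Set.inter_self X)) ?_
  rw [← chi_compl hX]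
  exact h

/-- An operator that acts on a set acts as the identity on functions supported in its
complement. -/
theorem ActsOn.apply_eq_self (h : ActsOn A X hX) {ψ : L2 n} (hψ : chi X hX ψ = 0) : A ψ = ψ := by
  have h1 := congr($(h.sub_one_eq) ψ)
  rw [mul_apply_eq_comp, mul_apply_eq_comp, hψ, map_zero, map_zero, sub_apply, sub_eq_zero] at h1
  exact h1

/-- If `A` acts on `X`, and some set `Y` disjoint from `X` is not a null set, then `‖A‖ ≥ 1`,
whence this bound. -/
theorem ActsOn.norm_sub_one_le (h : ActsOn A X hX) (hXY : X ∩ Y = ∅) (hne : chi Y hY ≠ 0) :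
    ‖A - 1‖ ≤ 2 * ‖A‖ := by
  obtain ⟨ψ, hψ⟩ : ∃ ψ, chi Y hY ψ ≠ 0 := by
    by_contra! hall
    exact hne (ContinuousLinearMap.ext hall)
  have h0 : chi X hX (chi Y hY ψ) = 0 := by
    rw [← mul_apply_eq_comp, chi_mul_chi hX hY MeasurableSet.empty hXY, chi_empty, zero_apply]
  have h1 := A.le_opNorm (chi Y hY ψ)
  rw [h.apply_eq_self h0] at h1
  have h2 : 1 ≤ ‖A‖ := le_of_mul_le_mul_right (by rwa [one_mul]) (norm_pos_iff.2 hψ)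
  refine (norm_sub_le _ _).trans ?_
  have h3 : ‖(1 : L2 n →L[ℂ] L2 n)‖ ≤ 1 := ContinuousLinearMap.norm_id_le
  linarith

theorem ActsOn.eq_one_of_chi_eq_zero (h : ActsOn A X hX) (h0 : chi X hX = 0) : A = 1 := by
  have h1 := h.sub_one_eq
  rw [h0, mul_zero] at h1
  exact sub_eq_zero.1 h1

end Commutator

end LiebRobinson

end

open LiebRobinson in
theorem mainTheorem2 (n : ℕ) :
    ∃ C : ℝ → ℝ, (∀ c : ℝ, 0 < c → 0 < C c) ∧
      ∀ (a μ : ℝ), 0 < μ → μ < a →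
      ∀ H : LiebRobinson.L2 n →ₗ.[ℂ] LiebRobinson.L2 n, IsSelfAdjoint H →
        LiebRobinson.ConditionA H a →
        ∃ c : ℝ, 0 < c ∧
          ∀ (X Y : Set (LiebRobinson.Space n)) (hX : MeasurableSet X) (hY : MeasurableSet Y),
            0 < LiebRobinson.setDist X Y →
            ∀ A B : LiebRobinson.L2 n →L[ℂ] LiebRobinson.L2 n,
              LiebRobinson.ActsOn A X hX → LiebRobinson.ActsOn B Y hY →
              ∀ t : ℝ,
                ‖LiebRobinson.heisenberg H t A ∘L B - B ∘L LiebRobinson.heisenberg H t A‖ ≤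
                  C c * Real.exp (-μ * (LiebRobinson.setDist X Y - c * |t|)) * ‖A‖ * ‖B‖ := by
  have hS := latticeSum_pos n
  refine ⟨fun c => 8 * latticeSum n * Real.exp (4 * √n * c), fun c _ => by positivity, ?_⟩
  intro a μ hμ hμa H hH hA
  obtain ⟨b, hb0, hb⟩ := hA.exists_norm_chi_propagator_chi_le_exp_setDist hH hμ hμa
  have hU := isUnitaryGroupOf_propagator hH
  -- `c` controls the velocity `b / μ` as well as the ratio `(a + μ) / (a - μ)`, which enters the
  -- prefactor and blows up as `μ` approaches `a`
  set c : ℝ := max ((a + μ) / (a - μ)) (b / μ) with hc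
  have hc1 : (a + μ) / (a - μ) ≤ c := le_max_left _ _
  have hc2 : b ≤ μ * c := by
    rw [mul_comm, ← div_le_iff₀ hμ]
    exact le_max_right _ _
  have hc0 : 0 < c := (div_pos (by linarith) (by linarith)).trans_le hc1
  refine ⟨c, hc0, fun X Y hX hY hd A B hAX hBY t => ?_⟩
  have hXY := inter_eq_empty_of_setDist_pos hd
  have hYX : Y ∩ X = ∅ := by rwa [Set.inter_comm]
  set d := setDist X Y with hdef
  have hrhs : 0 ≤ 8 * latticeSum n * Real.exp (4 * √n * c) *
      Real.exp (-μ * (d - c * |t|)) * ‖A‖ * ‖B‖ := by positivity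
  -- an operator that acts on a null set is the identity and commutes with everything
  by_cases hX0 : chi X hX = 0
  · have hh : heisenberg H t A = 1 := by
      rw [hAX.eq_one_of_chi_eq_zero hX0]
      change propagator H (-t) ∘L propagator H t = 1
      rw [← hU.map_add, neg_add_cancel, hU.map_zero]
    have : heisenberg H t A ∘L B - B ∘L heisenberg H t A = 0 := by
      rw [hh]
      exact sub_self B
    rw [this, norm_zero]
    exact hrhs
  by_cases hY0 : chi Y hY = 0
  · have : heisenberg H t A ∘L B - B ∘L heisenberg H t A = 0 := by
      rw [hBY.eq_one_of_chi_eq_zero hY0]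
      exact sub_self (heisenberg H t A)
    rw [this, norm_zero]
    exact hrhs
  have hbound (s : ℝ) (hs : |s| = |t|) :
      latticeSum n * Real.exp (4 * √n * ((a + μ) / (a - μ))) * Real.exp (-μ * d + b * |s|) ≤
        latticeSum n * Real.exp (4 * √n * c) * Real.exp (-μ * (d - c * |t|)) := by
    have h1 : -μ * d + b * |s| ≤ -μ * (d - c * |t|) := by
      rw [hs]
      nlinarith [mul_le_mul_of_nonneg_right hc2 (abs_nonneg t)]
    gcongr
  have h1 := (hb X Y hX hY hd t).trans (hbound t rfl)
  have h2 := hb Y X hY hX (by rwa [setDist_comm]) (-t)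
  rw [setDist_comm Y X, ← hdef] at h2
  have h3 := h2.trans (hbound (-t) (abs_neg t))
  have huu : propagator H (-t) * propagator H t = 1 := by
    change propagator H (-t) ∘L propagator H t = 1
    rw [← hU.map_add, neg_add_cancel, hU.map_zero]
  have h4 := norm_mul_comm_sub_le huu (hU.norm_le_one t) (hU.norm_le_one (-t)) (norm_chi_le hX)
    (norm_chi_le hY) hAX.sub_one_eq hBY.sub_one_eq h1 h3 (hAX.norm_sub_one_le hXY hY0)
    (hBY.norm_sub_one_le hYX hX0)
  refine le_trans (le_of_eq ?_) (h4.trans (le_of_eq ?_))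
  · rfl
  · ring
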